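/- Let $(M,g)$ be a compact Riemannian manifold (smooth, without boundary) of dimension $n\ge 2$, let $p\in M$, and let $v,w\in T_pM$ be unit vectors with $\langle v,w\rangle=0$. For $\epsilon>0$ let $B_\epsilon(v^\perp)=\{x\in T_pM:\langle v,x\rangle=0,\ \|x\|<\epsilon\}$, let $\nu$ be the smooth unit normal vector field with $\nu(p)=v$ on the hypersurface $\exp_p(B_\epsilon(v^\perp))$, and put $\exp^{\perp}(t,x)=\exp\bigl(t\,\nu(\exp_p x)\bigr)$. Let $\zeta:(v^\perp,g_p)\to\mathbb R^{n-1}$, with coordinates $(x_2,\dots,x_n)$ on $\mathbb R^{n-1}$, be a linear isometry with $\zeta(w)=e_2=(1,0,\dots,0)$, let $D^{n-1}(\epsilon)\subset\mathbb R^{n-1}$ be the open disc of radius $\epsilon$ around $0$, and define $$\xi:[-2\eta,2\eta]\times D^{n-1}(\epsilon)\to M,\qquad \xi(t,y)=\exp^{\perp}(t,\zeta^{-1}(y)).$$ Suppose that $0<6\epsilon<\eta$ and that $\xi$ is a diffeomorphism onto its image. Put $$P(v,w)=\{\exp^{\perp}(t,rw): t\in[-2\eta,2\eta],\ -\epsilon<r<\epsilon\},$$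 $$U_v^-(\eta,\epsilon)=\exp^{\perp}\bigl((-\eta-6\epsilon,-\eta)\times B_\epsilon(v^\perp)\bigr),\qquad U_v^+(\eta,\epsilon)=\exp^{\perp}\bigl((\eta,\eta+6\epsilon)\times B_\epsilon(v^\perp)\bigr),$$ and let $c(t)=\exp_p(tv)=\xi(t,0)$ for $t\in[-2\eta,2\eta]$. Then there are $\delta>0$, a smooth one-parameter family of Riemannian metrics $g^{(s)}$, $s\in[0,\delta]$, on $M$ with $g^{(0)}=g$ (smooth jointly in $s$ and the point of $M$), and smooth functions $u_s:[-2\eta,2\eta]\to[0,\epsilon)$, $s\in[0,\delta]$, such that for every $s\in[0,\delta]$: 1. the curve $c_s(t)=\xi(t,u_s(t),0,\dots,0)$, $t\in[-2\eta,2\eta]$, is a geodesic of $g^{(s)}$ parametrized by arc length; 2. $u_s(t)=0$ for $t\in[-2\eta,-\eta-4\epsilon]\cup[\eta+4\epsilon,2\eta]$, and $u_s(t)=s$ for $t\in[-\eta-2\epsilon,\eta+2\epsilon]$; 3. $u_s'(t)\,t\le 0$ for all $t\in[-2\eta,2\eta]$; in particular $u_s$ is monotone increasing on $[-2\eta,-\eta]$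 and monotone decreasing on $[\eta,2\eta]$; 4. if $s>0$, then $c_s$ lies in $P(v,w)\setminus\{p\}$; 5. the length of $c_s$ with respect to $g^{(s)}$ equals the length of $c$ with respect to $g$, namely $4\eta$; 6. $g^{(s)}$ and $g$ coincide outside $U_v^-(\eta,\epsilon)\cup U_v^+(\eta,\epsilon)$. -/

import Mathlib

open Set
open scoped Manifold ContDiff

noncomputable section

/-- Smooth Riemannian metrics on an `n`-dimensional smooth manifold without boundary. -/
abbrev SmoothMetric (n : ℕ) (M : Type*) [TopologicalSpace M]
    [ChartedSpace (EuclideanSpace ℝ (Fin n)) M] [IsManifold (𝓡 n) ∞ M] :=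
  Bundle.ContMDiffRiemannianMetric (𝓡 n) ∞ (EuclideanSpace ℝ (Fin n))
    (TangentSpace (𝓡 n) : M → Type _)

namespace SmoothMetric

variable {n : ℕ} {M : Type*} [TopologicalSpace M]
  [ChartedSpace (EuclideanSpace ℝ (Fin n)) M] [IsManifold (𝓡 n) ∞ M]

/-- The metric in the chart around `x₀`: the value at the coordinate point `y` on the coordinate
vectors `a`, `b`. -/
def inChart (g : SmoothMetric n M) (x₀ : M) (y a b : EuclideanSpace ℝ (Fin n)) : ℝ :=
  g.inner ((extChartAt (𝓡 n) x₀).symm y)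
    (mfderiv (𝓡 n) (𝓡 n) (extChartAt (𝓡 n) x₀).symm y a)
    (mfderiv (𝓡 n) (𝓡 n) (extChartAt (𝓡 n) x₀).symm y b)

/-- Christoffel symbol of the first kind in the chart around `x₀`, contracted with `a`, `b`, `e`:
`(∂_a g(b, e) + ∂_b g(a, e) - ∂_e g(a, b)) / 2`. -/
def christoffel (g : SmoothMetric n M) (x₀ : M) (y a b e : EuclideanSpace ℝ (Fin n)) : ℝ :=
  (fderiv ℝ (fun z => g.inChart x₀ z b e) y a + fderiv ℝ (fun z => g.inChart x₀ z a e) y b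
    - fderiv ℝ (fun z => g.inChart x₀ z a b) y e) / 2

/-- `c` restricted to `s` (an interval with non-empty interior) is a geodesic of `g`: it is smooth
and satisfies, in every chart, the geodesic equation `g(x'', e) + Γ(x', x'; e) = 0` for all `e`
(the equation `x'' + Γ(x', x') = 0` with the index lowered). -/
def IsGeodesicOn (g : SmoothMetric n M) (c : ℝ → M) (s : Set ℝ) : Prop :=
  ContMDiffOn 𝓘(ℝ, ℝ) (𝓡 n) ∞ c s ∧
  ∀ x₀ : M, ∀ t ∈ s, c t ∈ (extChartAt (𝓡 n) x₀).source →
    let x : ℝ → EuclideanSpace ℝ (Fin n) := fun τ => extChartAt (𝓡 n) x₀ (c τ)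
    let x' : ℝ → EuclideanSpace ℝ (Fin n) := derivWithin x s
    ∀ e : EuclideanSpace ℝ (Fin n),
      g.inChart x₀ (x t) (derivWithin x' s t) e + g.christoffel x₀ (x t) (x' t) (x' t) e = 0

end SmoothMetric

/-- The velocity vector at time `t` of the curve `c` restricted to `s`. -/
def curveVelocity (n : ℕ) {M : Type*} [TopologicalSpace M]
    [ChartedSpace (EuclideanSpace ℝ (Fin n)) M] (c : ℝ → M) (s : Set ℝ) (t : ℝ) :
    TangentSpace (𝓡 n) (c t) :=
  mfderivWithin 𝓘(ℝ, ℝ) (𝓡 n) c s t (1 : ℝ)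

namespace SmoothMetric

variable {n : ℕ} {M : Type*} [TopologicalSpace M]
  [ChartedSpace (EuclideanSpace ℝ (Fin n)) M] [IsManifold (𝓡 n) ∞ M]

/-- The length of `c` on `[a, b]`. -/
def curveLength (g : SmoothMetric n M) (c : ℝ → M) (a b : ℝ) : ℝ :=
  ∫ t in a..b, Real.sqrt
    (g.inner (c t) (curveVelocity n c (Icc a b) t) (curveVelocity n c (Icc a b) t))

/-- `c : ℝ → M` is a geodesic of `g`, defined for all times, with `c(0) = q` and `c'(0) = x`. -/
def IsGeodesicFrom (g : SmoothMetric n M) (q : M) (x : TangentSpace (𝓡 n) q) (c : ℝ → M) : Prop :=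
  g.IsGeodesicOn c univ ∧
    (⟨c 0, curveVelocity n c univ 0⟩ : TangentBundle (𝓡 n) M) = ⟨q, x⟩

open Classical in
/-- The exponential map of a complete (in particular, of a compact) Riemannian manifold:
`exp_q(x) = c(1)` for the geodesic `c` with `c(0) = q`, `c'(0) = x`
(and the conventional value `q` if no such geodesic exists). -/
def expMap (g : SmoothMetric n M) (q : M) (x : TangentSpace (𝓡 n) q) : M :=
  if h : ∃ c : ℝ → M, g.IsGeodesicFrom q x c then h.choose 1 else q

/-- The orthogonal complement of `v` in `T_pM`. -/
def normalSpace (g : SmoothMetric n M) (p : M) (v : TangentSpace (𝓡 n) p) :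
    Submodule ℝ (TangentSpace (𝓡 n) p) where
  carrier := {x | g.inner p v x = 0}
  add_mem' := by
    intro a b ha hb
    change g.inner p v (a + b) = 0
    change g.inner p v a = 0 at ha
    change g.inner p v b = 0 at hb
    rw [map_add, ha, hb, add_zero]
  zero_mem' := map_zero _
  smul_mem' := by
    intro r a ha
    change g.inner p v (r • a) = 0
    change g.inner p v a = 0 at ha
    rw [map_smul, ha, smul_zero]

/-- The open ball of radius `ε` around `0` in the orthogonal complement of `v`. -/
def normalBall (g : SmoothMetric n M) (p : M) (v : TangentSpace (𝓡 n) p) (ε : ℝ) :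
    Set (TangentSpace (𝓡 n) p) :=
  {x | x ∈ g.normalSpace p v ∧ Real.sqrt (g.inner p x x) < ε}

/-- The normal exponential map `(t, x) ↦ exp(t ν(exp_p x))`. -/
def normalExp (g : SmoothMetric n M) (p : M) (ν : (q : M) → TangentSpace (𝓡 n) q)
    (t : ℝ) (x : TangentSpace (𝓡 n) p) : M :=
  g.expMap (g.expMap p x) (t • ν (g.expMap p x))

/-- `U_v^-(η, ε)`. -/
def UMinus (g : SmoothMetric n M) (p : M) (v : TangentSpace (𝓡 n) p)
    (ν : (q : M) → TangentSpace (𝓡 n) q) (η ε : ℝ) : Set M :=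
  {q | ∃ t ∈ Ioo (-η - 6 * ε) (-η), ∃ x ∈ g.normalBall p v ε, q = g.normalExp p ν t x}

/-- `U_v^+(η, ε)`. -/
def UPlus (g : SmoothMetric n M) (p : M) (v : TangentSpace (𝓡 n) p)
    (ν : (q : M) → TangentSpace (𝓡 n) q) (η ε : ℝ) : Set M :=
  {q | ∃ t ∈ Ioo η (η + 6 * ε), ∃ x ∈ g.normalBall p v ε, q = g.normalExp p ν t x}

/-- The local surface `P(v, w)`. -/
def localSurface (g : SmoothMetric n M) (p : M) (w : TangentSpace (𝓡 n) p)
    (ν : (q : M) → TangentSpace (𝓡 n) q) (η ε : ℝ) : Set M :=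
  {q | ∃ t ∈ Icc (-2 * η) (2 * η), ∃ r ∈ Ioo (-ε) ε, q = g.normalExp p ν t (r • w)}

/-- `ζ`, a linear isomorphism of the orthogonal complement of `v` with `ℝᵏ`, is an isometry for
the inner product `g_p`. -/
def IsNormalIsometry (g : SmoothMetric n M) (p : M) (v : TangentSpace (𝓡 n) p) {k : ℕ}
    (ζ : g.normalSpace p v ≃ₗ[ℝ] EuclideanSpace ℝ (Fin k)) : Prop :=
  ∀ x y : g.normalSpace p v, inner ℝ (ζ x) (ζ y) = g.inner p x y

/-- The parametrization `y ↦ exp_p(ζ⁻¹ y)` of the hypersurface `Σ_{p,v}(ε)` by the open ball of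
radius `ε`. -/
def slice (g : SmoothMetric n M) (p : M) (v : TangentSpace (𝓡 n) p) {k : ℕ}
    (ζ : g.normalSpace p v ≃ₗ[ℝ] EuclideanSpace ℝ (Fin k)) (y : EuclideanSpace ℝ (Fin k)) : M :=
  g.expMap p (ζ.symm y : TangentSpace (𝓡 n) p)

/-- `ν` is the smooth unit normal vector field with `ν(p) = v` on the hypersurface
`Σ_{p,v}(ε) = exp_p(B_ε(v^⊥))`. The values of `ν` off this hypersurface are irrelevant. -/
def IsUnitNormalField (g : SmoothMetric n M) (p : M) (v : TangentSpace (𝓡 n) p) {k : ℕ}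
    (ζ : g.normalSpace p v ≃ₗ[ℝ] EuclideanSpace ℝ (Fin k)) (ε : ℝ)
    (ν : (q : M) → TangentSpace (𝓡 n) q) : Prop :=
  ContMDiffOn 𝓘(ℝ, EuclideanSpace ℝ (Fin k)) (𝓡 n).tangent ∞
      (fun y => (⟨g.slice p v ζ y, ν (g.slice p v ζ y)⟩ : TangentBundle (𝓡 n) M))
      (Metric.ball 0 ε) ∧
    (∀ y ∈ Metric.ball (0 : EuclideanSpace ℝ (Fin k)) ε,
      g.inner _ (ν (g.slice p v ζ y)) (ν (g.slice p v ζ y)) = 1 ∧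
      ∀ z : EuclideanSpace ℝ (Fin k), g.inner _ (ν (g.slice p v ζ y))
        (mfderiv 𝓘(ℝ, EuclideanSpace ℝ (Fin k)) (𝓡 n) (g.slice p v ζ) y z) = 0) ∧
    ν p = v

/-- The coordinates `ξ(t, y) = exp(t ν(exp_p(ζ⁻¹ y)))`. -/
def tubeMap (g : SmoothMetric n M) (p : M) (v : TangentSpace (𝓡 n) p) {k : ℕ}
    (ζ : g.normalSpace p v ≃ₗ[ℝ] EuclideanSpace ℝ (Fin k))
    (ν : (q : M) → TangentSpace (𝓡 n) q) (z : ℝ × EuclideanSpace ℝ (Fin k)) : M :=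
  g.normalExp p ν z.1 (ζ.symm z.2 : TangentSpace (𝓡 n) p)

end SmoothMetric

/-- `f` restricted to `A` is a diffeomorphism onto its image `f(A)`. -/
def IsDiffeoOntoImage {n k : ℕ} {M : Type*} [TopologicalSpace M]
    [ChartedSpace (EuclideanSpace ℝ (Fin n)) M]
    (f : ℝ × EuclideanSpace ℝ (Fin k) → M) (A : Set (ℝ × EuclideanSpace ℝ (Fin k))) : Prop :=
  ContMDiffOn 𝓘(ℝ, ℝ × EuclideanSpace ℝ (Fin k)) (𝓡 n) ∞ f A ∧
  ∃ h : M → ℝ × EuclideanSpace ℝ (Fin k),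
    ContMDiffOn (𝓡 n) 𝓘(ℝ, ℝ × EuclideanSpace ℝ (Fin k)) ∞ h (f '' A) ∧ LeftInvOn h f A

/-- The family of metrics `G s`, `s ∈ J`, is smooth (jointly in `s` and the point of `M`). -/
def IsSmoothFamilyOn {n : ℕ} {M : Type*} [TopologicalSpace M]
    [ChartedSpace (EuclideanSpace ℝ (Fin n)) M] [IsManifold (𝓡 n) ∞ M]
    (G : ℝ → SmoothMetric n M) (J : Set ℝ) : Prop :=
  ContMDiffOn (𝓘(ℝ, ℝ).prod (𝓡 n))
    ((𝓡 n).prod 𝓘(ℝ, EuclideanSpace ℝ (Fin n) →L[ℝ] EuclideanSpace ℝ (Fin n) →L[ℝ] ℝ)) ∞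
    (fun z : ℝ × M => Bundle.TotalSpace.mk'
      (EuclideanSpace ℝ (Fin n) →L[ℝ] EuclideanSpace ℝ (Fin n) →L[ℝ] ℝ)
      (E := fun q : M => TangentSpace (𝓡 n) q →L[ℝ] TangentSpace (𝓡 n) q →L[ℝ] ℝ)
      z.2 ((G z.1).inner z.2))
    (J ×ˢ univ)

end

/-!
The proof replaces the coordinates `ξ` by a shear of themselves. In the coordinates
`ξ(t, y) = exp(t ν(exp_p (ζ⁻¹ y)))` the lines `t ↦ ξ(t, y)` are unit speed geodesics orthogonal to
the slice `t = 0` (`IsGeodesicTube`, `isGeodesicTube_tubeMap`). That these geodesics exist for all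
times is read off from the injectivity of `ξ`: where the geodesic is missing, the exponential map
is constant on the line. That `exp` is computed by any geodesic with the right initial data is the
uniqueness of geodesics, from the uniqueness theorem for the ordinary differential equation of
position and velocity in a chart (`IsGeodesicFrom.unique`).

Geodesics are handled through Gram coefficients. For a map `f` into `M`, the first variation
identity `fderiv_gram_sub` says that `∂_a g(∂_a f, ∂_ζ f) - ∂_ζ g(∂_a f, ∂_a f) / 2` is the pairing
of `∂_ζ f` with the covariant acceleration of `f` in the direction `a`. It gives that geodesics have
constant speed, the Gauss lemma `g(∂_t ξ, ∂_ζ ξ) = dt(ζ)` (`IsGeodesicTube.gauss`), and conversely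
that a coordinate line along which the left-hand side vanishes for all `ζ` is a geodesic
(`geodesicEqAt_of_fderiv_gram`).

Let `e` be the first basis vector of `ℝ^(n-1)`, `ρ` an even profile which is `1` on
`|t| ≤ η + 2ε` and `0` for `|t| ≥ η + 4ε`, and `ψ` a bump function around `0`, equal to `1` on the
ball of radius `ε / 3` and to `0` off the ball of radius `ε / 2`. Put `u_s = s ρ` and
`φ(t, y) = ρ'(t) ψ(y)`. The field of endomorphisms `A = φ g(∂_t ξ, ·) ⊗ ∂_e ξ` (`tubeEndo`) is
smooth, vanishes outside `U_v^- ∪ U_v^+`, and is `φ dt ⊗ ∂_e` by the Gauss lemma; so `A² = 0`, and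
`g^(s)(x, y) = g(x - s A x, y - s A y)` is a smooth family of metrics (`shear`). Let
`Θ(t, y) = (t, y + u_s(t) e)`, which takes the axis of the tube to the curve
`c_s(t) = ξ(t, u_s(t) e)`. Near the axis `ψ ∘ Θ = 1` for `s ≤ ε / 4`, so `1 - s A` takes
`∂_ζ (ξ ∘ Θ)` to `∂_ζ ξ`. Hence the Gram coefficients `g^(s)(∂_t (ξ ∘ Θ), ∂_ζ (ξ ∘ Θ))` are those
of the Gauss lemma, and `c_s` is a unit speed geodesic of `g^(s)` (`geodesicEqAt_shear`). At the
endpoints `t = ±2η`, where `ξ` need not be smooth on a neighbourhood, `c_s` is an arc of the axis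
and the metric is unchanged.
-/

open Filter Topology

-- Mathlib's own setting: the instances on bundles of bilinear forms are found with it.
set_option maxSynthPendingDepth 3
set_option linter.unusedSectionVars false

noncomputable section

/-! ### The metric in coordinates -/

namespace SmoothMetric

variable {n : ℕ} {M : Type*} [TopologicalSpace M]
  [ChartedSpace (EuclideanSpace ℝ (Fin n)) M] [IsManifold (𝓡 n) ∞ M]

/-- Pairing two smooth vector fields along a map gives a smooth function. -/
theorem contMDiffAt_inner {EN HN N : Type*} [NormedAddCommGroup EN] [NormedSpace ℝ EN]
    [TopologicalSpace HN] {IN : ModelWithCorners ℝ EN HN} [TopologicalSpace N] [ChartedSpace HN N]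
    (g : SmoothMetric n M) {b : N → M} {X Y : ∀ z : N, TangentSpace (𝓡 n) (b z)} {z₀ : N}
    (hX : ContMDiffAt IN (𝓡 n).tangent ∞ (fun z => (⟨b z, X z⟩ : TangentBundle (𝓡 n) M)) z₀)
    (hY : ContMDiffAt IN (𝓡 n).tangent ∞ (fun z => (⟨b z, Y z⟩ : TangentBundle (𝓡 n) M)) z₀) :
    ContMDiffAt IN 𝓘(ℝ, ℝ) ∞ (fun z => g.inner (b z) (X z) (Y z)) z₀ := by
  have hb : ContMDiffAt IN (𝓡 n) ∞ b z₀ := (Bundle.contMDiffAt_totalSpace.1 hX).1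
  have : ContMDiffAt IN ((𝓡 n).prod 𝓘(ℝ)) ∞
      (fun z => Bundle.TotalSpace.mk' ℝ (E := Bundle.Trivial M ℝ) (b z)
        (g.inner (b z) (X z) (Y z))) z₀ := by
    apply ContMDiffAt.clm_bundle_apply₂ (F₁ := EuclideanSpace ℝ (Fin n))
      (F₂ := EuclideanSpace ℝ (Fin n))
    · exact ContMDiffAt.comp z₀ g.contMDiff.contMDiffAt hb
    · exact hX
    · exact hY
  exact (Bundle.contMDiffAt_totalSpace.1 this).2

section Param

variable {P : Type*} [NormedAddCommGroup P] [NormedSpace ℝ P]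

theorem contMDiffAt_mfderiv_apply {f : P → M} {z₀ : P} (hf : ContMDiffAt 𝓘(ℝ, P) (𝓡 n) ∞ f z₀)
    (a : P) :
    ContMDiffAt 𝓘(ℝ, P) (𝓡 n).tangent ∞
      (fun z => (⟨f z, mfderiv 𝓘(ℝ, P) (𝓡 n) f z a⟩ : TangentBundle (𝓡 n) M)) z₀ := by
  have h := ContMDiffAt.mfderiv_const (m := ∞) hf (by simp)
  have hv : ContMDiffAt 𝓘(ℝ, P) 𝓘(ℝ, P).tangent ∞
      (fun z => (⟨z, a⟩ : TangentBundle 𝓘(ℝ, P) P)) z₀ :=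
    (contMDiffAt_vectorSpace_iff_contDiffAt (E := P) (V := fun _ => a)).2 contDiffAt_const
  exact h.clm_apply_of_inCoordinates hv hf

/-- The Gram coefficients `g(∂_a f, ∂_b f)` of a smooth map into `M`. -/
def gram (g : SmoothMetric n M) (f : P → M) (a b z : P) : ℝ :=
  g.inner (f z) (mfderiv 𝓘(ℝ, P) (𝓡 n) f z a) (mfderiv 𝓘(ℝ, P) (𝓡 n) f z b)

theorem contDiffAt_gram (g : SmoothMetric n M) {f : P → M} {z₀ : P}
    (hf : ContMDiffAt 𝓘(ℝ, P) (𝓡 n) ∞ f z₀) (a b : P) : ContDiffAt ℝ ∞ (g.gram f a b) z₀ :=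
  (g.contMDiffAt_inner (contMDiffAt_mfderiv_apply hf a)
    (contMDiffAt_mfderiv_apply hf b)).contDiffAt

/-- The metric in the chart around `x₀`, as a bilinear form depending on the coordinate point. -/
def chartForm (g : SmoothMetric n M) (x₀ : M) (y : EuclideanSpace ℝ (Fin n)) :
    EuclideanSpace ℝ (Fin n) →L[ℝ] EuclideanSpace ℝ (Fin n) →L[ℝ] ℝ :=
  let D : EuclideanSpace ℝ (Fin n) →L[ℝ] TangentSpace (𝓡 n) ((extChartAt (𝓡 n) x₀).symm y) :=
    mfderiv (𝓡 n) (𝓡 n) (extChartAt (𝓡 n) x₀).symm y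
  (ContinuousLinearMap.precomp ℝ D).comp ((g.inner ((extChartAt (𝓡 n) x₀).symm y)).comp D)

@[simp]
theorem chartForm_apply (g : SmoothMetric n M) (x₀ : M) (y a b : EuclideanSpace ℝ (Fin n)) :
    g.chartForm x₀ y a b = g.inChart x₀ y a b := rfl

theorem contDiffAt_chartForm (g : SmoothMetric n M) {x₀ : M} {y : EuclideanSpace ℝ (Fin n)}
    (hy : y ∈ (extChartAt (𝓡 n) x₀).target) : ContDiffAt ℝ ∞ (g.chartForm x₀) y := by
  have ho : IsOpen (extChartAt (𝓡 n) x₀).target := isOpen_extChartAt_target x₀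
  have : ContDiffOn ℝ ∞ (g.chartForm x₀) (extChartAt (𝓡 n) x₀).target := by
    refine contDiffOn_clm_apply.2 fun a => contDiffOn_clm_apply.2 fun b => fun y hy => ?_
    have hs : ContMDiffAt 𝓘(ℝ, EuclideanSpace ℝ (Fin n)) (𝓡 n) ∞ (extChartAt (𝓡 n) x₀).symm y :=
      (contMDiffOn_extChartAt_symm x₀).contMDiffAt (ho.mem_nhds hy)
    exact (g.contDiffAt_gram hs a b).contDiffWithinAt
  exact this.contDiffAt (ho.mem_nhds hy)

/-- A derivative of `f` computed in the chart around `x₀` and carried back to `M`. -/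
theorem mfderiv_extChartAt_symm_comp {f : P → M} {z₀ : P}
    (hf : MDifferentiableAt 𝓘(ℝ, P) (𝓡 n) f z₀) {x₀ : M}
    (hx : f z₀ ∈ (extChartAt (𝓡 n) x₀).source) (a : P) :
    mfderiv (𝓡 n) (𝓡 n) (extChartAt (𝓡 n) x₀).symm (extChartAt (𝓡 n) x₀ (f z₀))
      (fderiv ℝ (fun z => extChartAt (𝓡 n) x₀ (f z)) z₀ a) = mfderiv 𝓘(ℝ, P) (𝓡 n) f z₀ a := by
  have hc : (extChartAt (𝓡 n) x₀ (f z₀)) ∈ (extChartAt (𝓡 n) x₀).target :=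
    (extChartAt (𝓡 n) x₀).map_source hx
  have h1 : MDifferentiableAt 𝓘(ℝ, P) 𝓘(ℝ, EuclideanSpace ℝ (Fin n))
      (fun z => extChartAt (𝓡 n) x₀ (f z)) z₀ :=
    MDifferentiableAt.comp z₀ (mdifferentiableAt_extChartAt (by simpa using hx)) hf
  have h2 : MDifferentiableAt 𝓘(ℝ, EuclideanSpace ℝ (Fin n)) (𝓡 n) (extChartAt (𝓡 n) x₀).symm
      (extChartAt (𝓡 n) x₀ (f z₀)) :=
    ((contMDiffOn_extChartAt_symm (n := ∞) x₀).contMDiffAt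
      ((isOpen_extChartAt_target x₀).mem_nhds hc)).mdifferentiableAt (by simp)
  have h3 := mfderiv_comp_apply z₀ h2 h1 a
  rw [mfderiv_eq_fderiv] at h3
  have h4 : ((extChartAt (𝓡 n) x₀).symm ∘ fun z => extChartAt (𝓡 n) x₀ (f z)) =ᶠ[𝓝 z₀] f := by
    have : f ⁻¹' (extChartAt (𝓡 n) x₀).source ∈ 𝓝 z₀ :=
      hf.continuousAt.preimage_mem_nhds ((isOpen_extChartAt_source x₀).mem_nhds hx)
    filter_upwards [this] with z hz
    exact (extChartAt (𝓡 n) x₀).left_inv hz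
  rw [h4.mfderiv_eq] at h3
  exact h3.symm

/-- The Gram coefficients computed in a chart. -/
theorem inChart_fderiv (g : SmoothMetric n M) {f : P → M} {z₀ : P}
    (hf : MDifferentiableAt 𝓘(ℝ, P) (𝓡 n) f z₀) {x₀ : M}
    (hx : f z₀ ∈ (extChartAt (𝓡 n) x₀).source) (a b : P) :
    g.inChart x₀ (extChartAt (𝓡 n) x₀ (f z₀))
      (fderiv ℝ (fun z => extChartAt (𝓡 n) x₀ (f z)) z₀ a)
      (fderiv ℝ (fun z => extChartAt (𝓡 n) x₀ (f z)) z₀ b) = g.gram f a b z₀ := by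
  unfold inChart gram
  rw [mfderiv_extChartAt_symm_comp hf hx, mfderiv_extChartAt_symm_comp hf hx,
    (extChartAt (𝓡 n) x₀).left_inv hx]

end Param

/-! ### The first variation identity -/

theorem inChart_symm (g : SmoothMetric n M) (x₀ : M) (y a b : EuclideanSpace ℝ (Fin n)) :
    g.inChart x₀ y a b = g.inChart x₀ y b a := g.symm _ _ _

/-- The Christoffel symbols as derivatives of a map with values in bilinear forms. -/
theorem christoffel_eq (g : SmoothMetric n M) {x₀ : M} {y : EuclideanSpace ℝ (Fin n)}
    (hy : y ∈ (extChartAt (𝓡 n) x₀).target) (a b e : EuclideanSpace ℝ (Fin n)) :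
    g.christoffel x₀ y a b e = (fderiv ℝ (g.chartForm x₀) y a b e
      + fderiv ℝ (g.chartForm x₀) y b a e - fderiv ℝ (g.chartForm x₀) y e a b) / 2 := by
  have hd : DifferentiableAt ℝ (g.chartForm x₀) y :=
    (g.contDiffAt_chartForm hy).differentiableAt (by simp)
  have key : ∀ b e a, fderiv ℝ (fun z => g.inChart x₀ z b e) y a =
      fderiv ℝ (g.chartForm x₀) y a b e := by
    intro b e a
    have h : HasFDerivAt (fun z => g.chartForm x₀ z b e) _ y :=
      (hd.hasFDerivAt.clm_apply (hasFDerivAt_const b y)).clm_apply (hasFDerivAt_const e y)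
    have h' : fderiv ℝ (fun z => g.inChart x₀ z b e) y = _ := h.fderiv
    rw [h']
    simp
  unfold christoffel
  rw [key, key, key]

section Param

variable {P : Type*} [NormedAddCommGroup P] [NormedSpace ℝ P]

theorem contDiffAt_extChartAt_comp {f : P → M} {z₀ : P} (hf : ContMDiffAt 𝓘(ℝ, P) (𝓡 n) ∞ f z₀)
    {x₀ : M} (hx : f z₀ ∈ (extChartAt (𝓡 n) x₀).source) :
    ContDiffAt ℝ ∞ (fun z => extChartAt (𝓡 n) x₀ (f z)) z₀ := by
  have h : ContMDiffAt (𝓡 n) 𝓘(ℝ, EuclideanSpace ℝ (Fin n)) ∞ (extChartAt (𝓡 n) x₀) (f z₀) :=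
    contMDiffAt_extChartAt' (by simpa using hx)
  exact (ContMDiffAt.comp z₀ h hf).contDiffAt

theorem eventually_contMDiffAt {f : P → M} {z₀ : P} (hf : ContMDiffAt 𝓘(ℝ, P) (𝓡 n) ∞ f z₀) :
    ∀ᶠ z in 𝓝 z₀, ContMDiffAt 𝓘(ℝ, P) (𝓡 n) 1 f z :=
  (contMDiffAt_iff_contMDiffAt_nhds (by simp)).1 (hf.of_le (by simp))

/-- The derivative of a smooth curve in a normed space is smooth. -/
theorem _root_.ContDiffAt.deriv_smooth {F : Type*} [NormedAddCommGroup F] [NormedSpace ℝ F]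
    {x : ℝ → F} {t : ℝ} (hx : ContDiffAt ℝ ∞ x t) : ContDiffAt ℝ ∞ (deriv x) t := by
  have h : ContDiffAt ℝ ∞ (fun τ => fderiv ℝ x τ 1) t :=
    (hx.fderiv_right (m := ∞) (by simp)).clm_apply contDiffAt_const
  exact h

/-- The first variation identity: for a map `f` into `M` and directions `a`, `ζ`, the expression
`∂_a g(∂_a f, ∂_ζ f) - ∂_ζ g(∂_a f, ∂_a f) / 2` is the pairing of `∂_ζ f` with the covariant
acceleration of the curve traced by `f` in the direction `a`. -/
theorem fderiv_gram_sub (g : SmoothMetric n M) {f : P → M} {z₀ : P}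
    (hf : ContMDiffAt 𝓘(ℝ, P) (𝓡 n) ∞ f z₀) {x₀ : M}
    (hx : f z₀ ∈ (extChartAt (𝓡 n) x₀).source) (a ζ : P) :
    fderiv ℝ (g.gram f a ζ) z₀ a - fderiv ℝ (g.gram f a a) z₀ ζ / 2 =
      g.inChart x₀ (extChartAt (𝓡 n) x₀ (f z₀))
        (fderiv ℝ (fun z => fderiv ℝ (fun z => extChartAt (𝓡 n) x₀ (f z)) z a) z₀ a)
        (fderiv ℝ (fun z => extChartAt (𝓡 n) x₀ (f z)) z₀ ζ) +
      g.christoffel x₀ (extChartAt (𝓡 n) x₀ (f z₀))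
        (fderiv ℝ (fun z => extChartAt (𝓡 n) x₀ (f z)) z₀ a)
        (fderiv ℝ (fun z => extChartAt (𝓡 n) x₀ (f z)) z₀ a)
        (fderiv ℝ (fun z => extChartAt (𝓡 n) x₀ (f z)) z₀ ζ) := by
  set x : P → EuclideanSpace ℝ (Fin n) := fun z => extChartAt (𝓡 n) x₀ (f z) with hxdef
  have hy : x z₀ ∈ (extChartAt (𝓡 n) x₀).target := (extChartAt (𝓡 n) x₀).map_source hx
  have hxs : ContDiffAt ℝ ∞ x z₀ := contDiffAt_extChartAt_comp hf hx
  have hx1 : HasFDerivAt x (fderiv ℝ x z₀) z₀ := (hxs.differentiableAt (by simp)).hasFDerivAt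
  have hx2 : HasFDerivAt (fderiv ℝ x) (fderiv ℝ (fderiv ℝ x) z₀) z₀ :=
    ((hxs.fderiv_right (m := ∞) (by simp)).differentiableAt (by simp)).hasFDerivAt
  have hsymm : ∀ u v, fderiv ℝ (fderiv ℝ x) z₀ u v = fderiv ℝ (fderiv ℝ x) z₀ v u := by
    have := hxs.isSymmSndFDerivAt (by simpa using WithTop.coe_le_coe.2 (le_top : (2 : ℕ∞) ≤ ⊤))
    exact fun u v => this u v
  have hB : HasFDerivAt (fun z => g.chartForm x₀ (x z))
      ((fderiv ℝ (g.chartForm x₀) (x z₀)).comp (fderiv ℝ x z₀)) z₀ :=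
    ((g.contDiffAt_chartForm hy).differentiableAt (by simp)).hasFDerivAt.comp z₀ hx1
  have hgram : ∀ b c : P, g.gram f b c =ᶠ[𝓝 z₀]
      fun z => g.chartForm x₀ (x z) (fderiv ℝ x z b) (fderiv ℝ x z c) := by
    intro b c
    have h1 : f ⁻¹' (extChartAt (𝓡 n) x₀).source ∈ 𝓝 z₀ :=
      hf.continuousAt.preimage_mem_nhds ((isOpen_extChartAt_source x₀).mem_nhds hx)
    filter_upwards [h1, eventually_contMDiffAt hf] with z hz1 hz2
    exact (g.inChart_fderiv (hz2.mdifferentiableAt (by simp)) hz1 b c).symm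
  have key : ∀ b c h : P, fderiv ℝ (g.gram f b c) z₀ h =
      fderiv ℝ (g.chartForm x₀) (x z₀) (fderiv ℝ x z₀ h) (fderiv ℝ x z₀ b) (fderiv ℝ x z₀ c)
      + g.chartForm x₀ (x z₀) (fderiv ℝ (fderiv ℝ x) z₀ h b) (fderiv ℝ x z₀ c)
      + g.chartForm x₀ (x z₀) (fderiv ℝ x z₀ b) (fderiv ℝ (fderiv ℝ x) z₀ h c) := by
    intro b c h
    rw [(hgram b c).fderiv_eq, ((hB.clm_apply (hx2.clm_apply (hasFDerivAt_const b z₀))).clm_apply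
      (hx2.clm_apply (hasFDerivAt_const c z₀))).fderiv]
    simp
    ring
  have hacc : fderiv ℝ (fun z => fderiv ℝ x z a) z₀ a = fderiv ℝ (fderiv ℝ x) z₀ a a := by
    rw [(hx2.clm_apply (hasFDerivAt_const a z₀)).fderiv]
    simp
  rw [key, key, hacc, g.christoffel_eq hy, hsymm a ζ]
  simp only [chartForm_apply]
  rw [g.inChart_symm x₀ (x z₀) (fderiv ℝ (fderiv ℝ x) z₀ ζ a)]
  ring

end Param

/-- The geodesic equation for `c` at a time `t` around which `c` is defined, in every chart. -/
def GeodesicEqAt (g : SmoothMetric n M) (c : ℝ → M) (t : ℝ) : Prop :=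
  ∀ x₀ : M, c t ∈ (extChartAt (𝓡 n) x₀).source → ∀ e : EuclideanSpace ℝ (Fin n),
    g.inChart x₀ (extChartAt (𝓡 n) x₀ (c t))
      (deriv (deriv fun τ => extChartAt (𝓡 n) x₀ (c τ)) t) e +
    g.christoffel x₀ (extChartAt (𝓡 n) x₀ (c t))
      (deriv (fun τ => extChartAt (𝓡 n) x₀ (c τ)) t)
      (deriv (fun τ => extChartAt (𝓡 n) x₀ (c τ)) t) e = 0

theorem isGeodesicOn_univ_iff (g : SmoothMetric n M) (c : ℝ → M) :
    g.IsGeodesicOn c univ ↔ ContMDiff 𝓘(ℝ, ℝ) (𝓡 n) ∞ c ∧ ∀ t, g.GeodesicEqAt c t := by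
  simp only [IsGeodesicOn, GeodesicEqAt, contMDiffOn_univ, mem_univ, true_imp_iff,
    derivWithin_univ]
  exact and_congr_right fun _ => forall_comm

/-- The geodesic equation on an interval follows from the equation for a curve which agrees with
the given one near the time considered; at an endpoint, this curve is an extension. -/
theorem geodesicEq_within {g : SmoothMetric n M} {c γ : ℝ → M} {s : Set ℝ} {t : ℝ}
    (hs : UniqueDiffOn ℝ s) (ht : t ∈ s) (hγ : ContMDiffAt 𝓘(ℝ, ℝ) (𝓡 n) ∞ γ t)
    (hgeo : g.GeodesicEqAt γ t) (heq : c =ᶠ[𝓝[s] t] γ) (x₀ : M)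
    (hx : c t ∈ (extChartAt (𝓡 n) x₀).source) (e : EuclideanSpace ℝ (Fin n)) :
    g.inChart x₀ (extChartAt (𝓡 n) x₀ (c t))
      (derivWithin (derivWithin (fun τ => extChartAt (𝓡 n) x₀ (c τ)) s) s t) e +
    g.christoffel x₀ (extChartAt (𝓡 n) x₀ (c t))
      (derivWithin (fun τ => extChartAt (𝓡 n) x₀ (c τ)) s t)
      (derivWithin (fun τ => extChartAt (𝓡 n) x₀ (c τ)) s t) e = 0 := by
  have ht' : c t = γ t := heq.self_of_nhdsWithin ht
  have hx' : γ t ∈ (extChartAt (𝓡 n) x₀).source := ht' ▸ hx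
  set xγ : ℝ → EuclideanSpace ℝ (Fin n) := fun τ => extChartAt (𝓡 n) x₀ (γ τ) with hxγ
  have hsm : ContDiffAt ℝ ∞ xγ t := contDiffAt_extChartAt_comp hγ hx'
  have hE : (fun τ => extChartAt (𝓡 n) x₀ (c τ)) =ᶠ[𝓝[s] t] xγ := by
    filter_upwards [heq] with τ hτ
    simp only [hxγ, hτ]
  have hd : ∀ᶠ τ in 𝓝 t, DifferentiableAt ℝ xγ τ := by
    filter_upwards [(hsm.of_le (m := 1) (by simp)).eventually (by simp)] with τ hτ
    exact hτ.differentiableAt (by simp)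
  have hE' : derivWithin (fun τ => extChartAt (𝓡 n) x₀ (c τ)) s =ᶠ[𝓝[s] t] deriv xγ := by
    filter_upwards [eventually_eventually_nhdsWithin.2 hE, self_mem_nhdsWithin,
      mem_nhdsWithin_of_mem_nhds hd] with τ h1 h2 h3
    rw [Filter.EventuallyEq.derivWithin_eq h1 (h1.self_of_nhdsWithin h2),
      h3.derivWithin (hs τ h2)]
  have hd2 : DifferentiableAt ℝ (deriv xγ) t :=
    hsm.deriv_smooth.differentiableAt (by simp)
  rw [hE'.derivWithin_eq (hE'.self_of_nhdsWithin ht), hd2.derivWithin (hs t ht),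
    hE'.self_of_nhdsWithin ht, ht']
  exact hgeo x₀ hx' e

/-! ### Geodesics and Gram coefficients -/

theorem contMDiffAt_comp_curve {P : Type*} [NormedAddCommGroup P] [NormedSpace ℝ P] {f : P → M}
    {ℓ : ℝ → P} {t : ℝ} (hℓ : ContDiffAt ℝ ∞ ℓ t) (hf : ContMDiffAt 𝓘(ℝ, P) (𝓡 n) ∞ f (ℓ t)) :
    ContMDiffAt 𝓘(ℝ, ℝ) (𝓡 n) ∞ (fun τ => f (ℓ τ)) t :=
  ContMDiffAt.comp t hf hℓ.contMDiffAt

section Param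

variable {P : Type*} [NormedAddCommGroup P] [NormedSpace ℝ P]

/-- The geodesic equation for a coordinate line `t ↦ f (ℓ t)` in the direction `a`. -/
theorem geodesicEqAt_line_iff (g : SmoothMetric n M) {f : P → M} {ℓ : ℝ → P} {a : P}
    (hℓ : ∀ t, HasDerivAt ℓ a t) {t : ℝ} (hf : ContMDiffAt 𝓘(ℝ, P) (𝓡 n) ∞ f (ℓ t)) :
    g.GeodesicEqAt (fun τ => f (ℓ τ)) t ↔ ∀ x₀ : M, f (ℓ t) ∈ (extChartAt (𝓡 n) x₀).source →
      ∀ e : EuclideanSpace ℝ (Fin n), g.inChart x₀ (extChartAt (𝓡 n) x₀ (f (ℓ t)))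
        (fderiv ℝ (fun z => fderiv ℝ (fun z => extChartAt (𝓡 n) x₀ (f z)) z a) (ℓ t) a) e +
      g.christoffel x₀ (extChartAt (𝓡 n) x₀ (f (ℓ t)))
        (fderiv ℝ (fun z => extChartAt (𝓡 n) x₀ (f z)) (ℓ t) a)
        (fderiv ℝ (fun z => extChartAt (𝓡 n) x₀ (f z)) (ℓ t) a) e = 0 := by
  unfold GeodesicEqAt
  refine forall_congr' fun x₀ => forall_congr' fun hx => ?_
  set x : P → EuclideanSpace ℝ (Fin n) := fun z => extChartAt (𝓡 n) x₀ (f z) with hxdef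
  have hxs : ContDiffAt ℝ ∞ x (ℓ t) := contDiffAt_extChartAt_comp hf hx
  have h1 : deriv (fun τ => extChartAt (𝓡 n) x₀ (f (ℓ τ))) =ᶠ[𝓝 t]
      fun τ => fderiv ℝ x (ℓ τ) a := by
    have he : ∀ᶠ z in 𝓝 (ℓ t), ContDiffAt ℝ 1 x z :=
      (hxs.of_le (m := 1) (by simp)).eventually (by simp)
    filter_upwards [(hℓ t).continuousAt.eventually he] with τ hτ
    exact ((hτ.differentiableAt (by simp)).hasFDerivAt.comp_hasDerivAt τ (hℓ τ)).deriv
  have h2 : deriv (fun τ => fderiv ℝ x (ℓ τ) a) t =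
      fderiv ℝ (fun z => fderiv ℝ x z a) (ℓ t) a := by
    have hd : DifferentiableAt ℝ (fun z => fderiv ℝ x z a) (ℓ t) :=
      (((hxs.fderiv_right (m := ∞) (by simp)).clm_apply contDiffAt_const).differentiableAt
        (by simp))
    exact (hd.hasFDerivAt.comp_hasDerivAt t (hℓ t)).deriv
  rw [h1.deriv_eq, h2, h1.self_of_nhds]

/-- Along a coordinate line which is a geodesic, the derivative of `g(∂_a f, ∂_ζ f)` is half the
derivative of the squared speed in the direction `ζ`. -/
theorem GeodesicEqAt.fderiv_gram {g : SmoothMetric n M} {f : P → M} {ℓ : ℝ → P} {a : P}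
    (hℓ : ∀ t, HasDerivAt ℓ a t) {t : ℝ} (hf : ContMDiffAt 𝓘(ℝ, P) (𝓡 n) ∞ f (ℓ t))
    (h : g.GeodesicEqAt (fun τ => f (ℓ τ)) t) (ζ : P) :
    fderiv ℝ (g.gram f a ζ) (ℓ t) a = fderiv ℝ (g.gram f a a) (ℓ t) ζ / 2 := by
  have hx : f (ℓ t) ∈ (extChartAt (𝓡 n) (f (ℓ t))).source := mem_extChartAt_source _
  have h1 := (geodesicEqAt_line_iff g hℓ hf).1 h _ hx
    (fderiv ℝ (fun z => extChartAt (𝓡 n) (f (ℓ t)) (f z)) (ℓ t) ζ)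
  rw [← g.fderiv_gram_sub hf hx] at h1
  linarith

/-- Converse of `GeodesicEqAt.fderiv_gram` for a local parametrization of `M`. -/
theorem geodesicEqAt_of_fderiv_gram [FiniteDimensional ℝ P] {g : SmoothMetric n M} {f : P → M}
    {ℓ : ℝ → P} {a : P} (hP : Module.finrank ℝ P = n) (hℓ : ∀ t, HasDerivAt ℓ a t) {t : ℝ}
    (hf : ContMDiffAt 𝓘(ℝ, P) (𝓡 n) ∞ f (ℓ t))
    (hinj : ∀ ζ : P, mfderiv 𝓘(ℝ, P) (𝓡 n) f (ℓ t) ζ = 0 → ζ = 0)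
    (h : ∀ ζ, fderiv ℝ (g.gram f a ζ) (ℓ t) a = fderiv ℝ (g.gram f a a) (ℓ t) ζ / 2) :
    g.GeodesicEqAt (fun τ => f (ℓ τ)) t := by
  refine (geodesicEqAt_line_iff g hℓ hf).2 fun x₀ hx e => ?_
  have hinj' : Function.Injective (fderiv ℝ (fun z => extChartAt (𝓡 n) x₀ (f z)) (ℓ t)) := by
    refine (injective_iff_map_eq_zero _).2 fun ζ hζ => hinj ζ ?_
    rw [← mfderiv_extChartAt_symm_comp (hf.mdifferentiableAt (by simp)) hx ζ, hζ]
    exact map_zero _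
  have hsurj : Function.Surjective (fderiv ℝ (fun z => extChartAt (𝓡 n) x₀ (f z)) (ℓ t)) :=
    (LinearMap.injective_iff_surjective_of_finrank_eq_finrank
      (f := (fderiv ℝ (fun z => extChartAt (𝓡 n) x₀ (f z)) (ℓ t)).toLinearMap)
      (by simp [hP])).1 hinj'
  obtain ⟨ζ, rfl⟩ := hsurj e
  rw [← g.fderiv_gram_sub hf hx, h]
  ring

end Param

/-- A geodesic has constant speed. -/
theorem IsGeodesicOn.gram_eq {g : SmoothMetric n M} {c : ℝ → M} (hc : g.IsGeodesicOn c univ)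
    (t : ℝ) : g.gram c 1 1 t = g.gram c 1 1 0 := by
  obtain ⟨hs, hgeo⟩ := (g.isGeodesicOn_univ_iff c).1 hc
  have hd : Differentiable ℝ (g.gram c (1 : ℝ) 1) := fun t =>
    (g.contDiffAt_gram (hs t) 1 1).differentiableAt (by simp)
  refine is_const_of_deriv_eq_zero hd (fun t => ?_) t 0
  have h := GeodesicEqAt.fderiv_gram (ℓ := fun t : ℝ => t) (a := (1 : ℝ))
    (fun t => hasDerivAt_id t) (hs t) (hgeo t) 1
  have h' : fderiv ℝ (g.gram c (1 : ℝ) 1) t 1 = 0 := by linarith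
  simpa using h'

/-- The geodesic equation at `t` only depends on the metric near `c t`. -/
theorem GeodesicEqAt.congr_metric {g g' : SmoothMetric n M} {c : ℝ → M} {t : ℝ}
    (h : g.GeodesicEqAt c t) (hg : ∀ᶠ q in 𝓝 (c t), g'.inner q = g.inner q) :
    g'.GeodesicEqAt c t := by
  intro x₀ hx e
  have hy : extChartAt (𝓡 n) x₀ (c t) ∈ (extChartAt (𝓡 n) x₀).target :=
    (extChartAt (𝓡 n) x₀).map_source hx
  have hcont : ContinuousAt (extChartAt (𝓡 n) x₀).symm (extChartAt (𝓡 n) x₀ (c t)) :=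
    continuousAt_extChartAt_symm'' hy
  have he : ∀ᶠ y in 𝓝 (extChartAt (𝓡 n) x₀ (c t)),
      ∀ a b, g'.inChart x₀ y a b = g.inChart x₀ y a b := by
    have := hcont.eventually (p := fun q => g'.inner q = g.inner q)
      (by rwa [(extChartAt (𝓡 n) x₀).left_inv hx])
    filter_upwards [this] with y hy a b
    unfold inChart
    rw [hy]
  have hf : ∀ a b, fderiv ℝ (fun z => g'.inChart x₀ z a b) (extChartAt (𝓡 n) x₀ (c t)) =
      fderiv ℝ (fun z => g.inChart x₀ z a b) (extChartAt (𝓡 n) x₀ (c t)) := fun a b =>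
    Filter.EventuallyEq.fderiv_eq (he.mono fun y hy => hy a b)
  have := h x₀ hx e
  unfold christoffel at this ⊢
  rw [he.self_of_nhds]
  simpa only [hf] using this

/-! ### Uniqueness of geodesics -/

/-- In the preferred chart at the point considered, the tangent coordinates of a velocity vector
are the derivative of the coordinates. -/
theorem mfderiv_one_eq_deriv {c : ℝ → M} {t : ℝ} (hc : MDifferentiableAt 𝓘(ℝ, ℝ) (𝓡 n) c t) :
    (mfderiv 𝓘(ℝ, ℝ) (𝓡 n) c t (1 : ℝ) : EuclideanSpace ℝ (Fin n)) =
      deriv (fun τ => extChartAt (𝓡 n) (c t) (c τ)) t := by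
  have h := hc.hasMFDerivAt.2
  simp only [writtenInExtChartAt, extChartAt_model_space_eq_id, PartialEquiv.refl_symm,
    PartialEquiv.refl_coe, Function.comp_def, id_eq, modelWithCornersSelf_coe, range_id] at h
  obtain ⟨L, hL⟩ : ∃ L : ℝ →L[ℝ] EuclideanSpace ℝ (Fin n), L = mfderiv 𝓘(ℝ, ℝ) (𝓡 n) c t :=
    ⟨_, rfl⟩
  rw [← hL] at h ⊢
  have h' : HasFDerivAt (fun τ => extChartAt (𝓡 n) (c t) (c τ)) L t := hasFDerivWithinAt_univ.1 h
  exact h'.hasDerivAt.deriv.symm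

theorem inChart_pos (g : SmoothMetric n M) {x₀ : M} {y : EuclideanSpace ℝ (Fin n)}
    (hy : y ∈ (extChartAt (𝓡 n) x₀).target) {a : EuclideanSpace ℝ (Fin n)} (ha : a ≠ 0) :
    0 < g.inChart x₀ y a a := by
  refine g.pos _ _ fun h0 => ha ?_
  have hi := isInvertible_mfderivWithin_extChartAt_symm (I := 𝓡 n) hy
  simp only [modelWithCornersSelf_coe, range_id, mfderivWithin_univ] at hi
  exact hi.injective (h0.trans (map_zero _).symm)

/-- In a chart, the metric identifies coordinate vectors with coordinate covectors. -/
theorem chartForm_eq_equiv (g : SmoothMetric n M) {x₀ : M} {y : EuclideanSpace ℝ (Fin n)}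
    (hy : y ∈ (extChartAt (𝓡 n) x₀).target) :
    ∃ B : EuclideanSpace ℝ (Fin n) ≃L[ℝ] (EuclideanSpace ℝ (Fin n) →L[ℝ] ℝ),
      (B : EuclideanSpace ℝ (Fin n) →L[ℝ] EuclideanSpace ℝ (Fin n) →L[ℝ] ℝ) =
        g.chartForm x₀ y := by
  have hinj : Function.Injective (g.chartForm x₀ y).toLinearMap := by
    refine (injective_iff_map_eq_zero _).2 fun a ha => ?_
    by_contra hne
    have h1 := g.inChart_pos hy hne
    have h2 : g.chartForm x₀ y a a = 0 := by
      have := congrArg (fun φ : EuclideanSpace ℝ (Fin n) →L[ℝ] ℝ => φ a) ha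
      simpa using this
    rw [chartForm_apply] at h2
    exact h1.ne' h2
  have hrank : Module.finrank ℝ (EuclideanSpace ℝ (Fin n)) =
      Module.finrank ℝ (EuclideanSpace ℝ (Fin n) →L[ℝ] ℝ) := by
    rw [← (LinearMap.toContinuousLinearMap (𝕜 := ℝ) (E := EuclideanSpace ℝ (Fin n))
      (F' := ℝ)).finrank_eq]
    exact (Subspace.dual_finrank_eq (K := ℝ) (V := EuclideanSpace ℝ (Fin n))).symm
  refine ⟨(LinearEquiv.ofInjectiveOfFinrankEq _ hinj hrank).toContinuousLinearEquiv, ?_⟩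
  ext a
  rfl

/-- The vector field of the geodesic equation, on position-velocity pairs, for a metric `B` on an
open set of a vector space. -/
def spray {V : Type*} [NormedAddCommGroup V] [NormedSpace ℝ V] (B : V → V →L[ℝ] V →L[ℝ] ℝ)
    (z : V × V) : V × V :=
  (z.2, -(B z.1).inverse (fderiv ℝ B z.1 z.2 z.2 -
    (1 / 2 : ℝ) • ((fderiv ℝ B z.1).flip z.2).flip z.2))

theorem contDiffAt_spray {V : Type*} [NormedAddCommGroup V] [NormedSpace ℝ V] [CompleteSpace V]
    {B : V → V →L[ℝ] V →L[ℝ] ℝ} {z : V × V} (hB : ContDiffAt ℝ ∞ B z.1)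
    (e : V ≃L[ℝ] (V →L[ℝ] ℝ)) (he : (e : V →L[ℝ] V →L[ℝ] ℝ) = B z.1) :
    ContDiffAt ℝ 1 (spray B) z := by
  have hB1 : ContDiffAt ℝ 1 (fun z : V × V => B z.1) z :=
    (hB.of_le (by simp)).comp z contDiffAt_fst
  have hB' : ContDiffAt ℝ 1 (fun z : V × V => fderiv ℝ B z.1) z :=
    ContDiffAt.comp z ((hB.fderiv_right (m := ∞) (by simp)).of_le (by simp)) contDiffAt_fst
  have hinv : ContDiffAt ℝ 1 (fun z : V × V => (B z.1).inverse) z := by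
    have h1 : ContDiffAt ℝ 1 ContinuousLinearMap.inverse (B z.1) := by
      rw [← he]
      exact contDiffAt_map_inverse e
    exact ContDiffAt.comp z h1 hB1
  have hflip : ContDiffAt ℝ 1 (fun z : V × V => (fderiv ℝ B z.1).flip) z :=
    (ContinuousLinearMap.flipₗᵢ ℝ V V (V →L[ℝ] ℝ)).toContinuousLinearEquiv.contDiff.contDiffAt.comp
      z hB'
  have hflip1 : ContDiffAt ℝ 1 (fun z : V × V => (fderiv ℝ B z.1).flip z.2) z :=
    hflip.clm_apply contDiffAt_snd
  have hflip2 : ContDiffAt ℝ 1 (fun z : V × V => ((fderiv ℝ B z.1).flip z.2).flip) z :=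
    (ContinuousLinearMap.flipₗᵢ ℝ V V ℝ).toContinuousLinearEquiv.contDiff.contDiffAt.comp z hflip1
  have h3 : ContDiffAt ℝ 1
      (fun z : V × V => (1 / 2 : ℝ) • ((fderiv ℝ B z.1).flip z.2).flip z.2) z :=
    (hflip2.clm_apply contDiffAt_snd).const_smul (1 / 2 : ℝ)
  have h4 : ContDiffAt ℝ 1 (fun z : V × V => fderiv ℝ B z.1 z.2) z := hB'.clm_apply contDiffAt_snd
  have h5 : ContDiffAt ℝ 1 (fun z : V × V => fderiv ℝ B z.1 z.2 z.2) z :=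
    h4.clm_apply contDiffAt_snd
  have h6 : ContDiffAt ℝ 1 (fun z : V × V => fderiv ℝ B z.1 z.2 z.2 -
    (1 / 2 : ℝ) • ((fderiv ℝ B z.1).flip z.2).flip z.2) z := h5.sub h3
  have h7 := (hinv.clm_apply h6).neg
  exact contDiffAt_snd.prodMk h7

theorem contDiffAt_spray_chartForm (g : SmoothMetric n M) {x₀ : M}
    {z : EuclideanSpace ℝ (Fin n) × EuclideanSpace ℝ (Fin n)}
    (hz : z.1 ∈ (extChartAt (𝓡 n) x₀).target) : ContDiffAt ℝ 1 (spray (g.chartForm x₀)) z := by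
  obtain ⟨e, he⟩ := g.chartForm_eq_equiv hz
  exact contDiffAt_spray (g.contDiffAt_chartForm hz) e he

/-- In a chart, position and velocity of a geodesic form an integral curve of the spray. -/
theorem GeodesicEqAt.hasDerivAt_chart {g : SmoothMetric n M} {c : ℝ → M} {t : ℝ} {x₀ : M}
    (hc : ContMDiffAt 𝓘(ℝ, ℝ) (𝓡 n) ∞ c t) (h : g.GeodesicEqAt c t)
    (hx : c t ∈ (extChartAt (𝓡 n) x₀).source) :
    HasDerivAt (fun τ => (extChartAt (𝓡 n) x₀ (c τ),
        deriv (fun τ => extChartAt (𝓡 n) x₀ (c τ)) τ))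
      (spray (g.chartForm x₀) (extChartAt (𝓡 n) x₀ (c t),
        deriv (fun τ => extChartAt (𝓡 n) x₀ (c τ)) t)) t := by
  have hxs := contDiffAt_extChartAt_comp hc hx
  have hy : extChartAt (𝓡 n) x₀ (c t) ∈ (extChartAt (𝓡 n) x₀).target :=
    (extChartAt (𝓡 n) x₀).map_source hx
  have h1 := (hxs.differentiableAt (by simp)).hasDerivAt
  have h2 := (hxs.deriv_smooth.differentiableAt (by simp)).hasDerivAt
  refine h1.prodMk ?_
  convert h2 using 1
  -- lowering the index turns the second component into the geodesic equation
  obtain ⟨B, hB⟩ := g.chartForm_eq_equiv hy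
  simp only
  rw [← hB, ContinuousLinearMap.inverse_equiv]
  rw [← map_neg]
  refine (ContinuousLinearEquiv.symm_apply_eq B).2 ?_
  ext e
  have h3 := h x₀ hx e
  rw [g.christoffel_eq hy, ← chartForm_apply, ← hB] at h3
  simp only [neg_apply, sub_apply, smul_apply, ContinuousLinearMap.flip_apply, smul_eq_mul]
  simp only [ContinuousLinearEquiv.coe_coe] at h3
  linarith

/-- Local uniqueness of geodesics. -/
theorem eventuallyEq_of_geodesic {g : SmoothMetric n M} {c₁ c₂ : ℝ → M} {t₀ : ℝ} {x₀ : M}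
    (h₁ : g.IsGeodesicOn c₁ univ) (h₂ : g.IsGeodesicOn c₂ univ) (h0 : c₁ t₀ = c₂ t₀)
    (hx : c₁ t₀ ∈ (extChartAt (𝓡 n) x₀).source)
    (hd : deriv (fun τ => extChartAt (𝓡 n) x₀ (c₁ τ)) t₀ =
      deriv (fun τ => extChartAt (𝓡 n) x₀ (c₂ τ)) t₀) : c₁ =ᶠ[𝓝 t₀] c₂ := by
  rw [isGeodesicOn_univ_iff] at h₁ h₂
  have hy : extChartAt (𝓡 n) x₀ (c₁ t₀) ∈ (extChartAt (𝓡 n) x₀).target :=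
    (extChartAt (𝓡 n) x₀).map_source hx
  obtain ⟨K, s, hs, hK⟩ := (g.contDiffAt_spray_chartForm (z := (extChartAt (𝓡 n) x₀ (c₁ t₀),
    deriv (fun τ => extChartAt (𝓡 n) x₀ (c₁ τ)) t₀)) hy).exists_lipschitzOnWith
  have key : ∀ c : ℝ → M, ContMDiff 𝓘(ℝ, ℝ) (𝓡 n) ∞ c → (∀ t, g.GeodesicEqAt c t) →
      c t₀ ∈ (extChartAt (𝓡 n) x₀).source → s ∈ 𝓝 (extChartAt (𝓡 n) x₀ (c t₀),
        deriv (fun τ => extChartAt (𝓡 n) x₀ (c τ)) t₀) →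
      (∀ᶠ t in 𝓝 t₀, HasDerivAt (fun τ => (extChartAt (𝓡 n) x₀ (c τ),
          deriv (fun τ => extChartAt (𝓡 n) x₀ (c τ)) τ))
        (spray (g.chartForm x₀) (extChartAt (𝓡 n) x₀ (c t),
          deriv (fun τ => extChartAt (𝓡 n) x₀ (c τ)) t)) t ∧
        (extChartAt (𝓡 n) x₀ (c t), deriv (fun τ => extChartAt (𝓡 n) x₀ (c τ)) t) ∈ s) ∧
      ∀ᶠ t in 𝓝 t₀, c t ∈ (extChartAt (𝓡 n) x₀).source := by
    intro c hc hgeo hx hs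
    have hsrc : ∀ᶠ t in 𝓝 t₀, c t ∈ (extChartAt (𝓡 n) x₀).source :=
      hc.continuous.continuousAt.preimage_mem_nhds
        ((isOpen_extChartAt_source x₀).mem_nhds hx)
    have hcont := ((hgeo t₀).hasDerivAt_chart (hc t₀) hx).continuousAt
    refine ⟨?_, hsrc⟩
    filter_upwards [hsrc, hcont.preimage_mem_nhds hs] with t ht1 ht2
    exact ⟨(hgeo t).hasDerivAt_chart (hc t) ht1, ht2⟩
  obtain ⟨hA, hA'⟩ := key c₁ h₁.1 h₁.2 hx hs
  obtain ⟨hB, hB'⟩ := key c₂ h₂.1 h₂.2 (h0 ▸ hx) (by rw [← hd, ← h0]; exact hs)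
  have := ODE_solution_unique_of_eventually (v := fun _ => spray (g.chartForm x₀)) (s := fun _ => s)
    (Eventually.of_forall fun _ => hK) hA hB (by rw [hd, h0])
  filter_upwards [this, hA', hB'] with t ht h1 h2
  exact (extChartAt (𝓡 n) x₀).injOn h1 h2 (congrArg Prod.fst ht)

/-- Uniqueness of geodesics with given initial position and velocity. -/
theorem IsGeodesicFrom.unique [T2Space M] {g : SmoothMetric n M} {q : M}
    {x : TangentSpace (𝓡 n) q} {c₁ c₂ : ℝ → M} (h₁ : g.IsGeodesicFrom q x c₁)
    (h₂ : g.IsGeodesicFrom q x c₂) : c₁ = c₂ := by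
  obtain ⟨hs₁, -⟩ := (g.isGeodesicOn_univ_iff c₁).1 h₁.1
  obtain ⟨hs₂, -⟩ := (g.isGeodesicOn_univ_iff c₂).1 h₂.1
  -- the set of times around which the curves agree is open, closed and contains `0`
  have hopen : IsOpen {t | c₁ =ᶠ[𝓝 t] c₂} := isOpen_setOfPred_eventually_nhds
  have hclosed : IsClosed {t | c₁ =ᶠ[𝓝 t] c₂} := by
    refine isClosed_of_closure_subset fun t₀ ht₀ => ?_
    have hfreq := mem_closure_iff_frequently.1 ht₀
    have h0 : c₁ t₀ = c₂ t₀ := by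
      have hcl : IsClosed {t | c₁ t = c₂ t} := isClosed_eq hs₁.continuous hs₂.continuous
      exact hcl.closure_subset_iff.2 (fun t ht => ht.self_of_nhds) ht₀
    have hx : c₁ t₀ ∈ (extChartAt (𝓡 n) (c₁ t₀)).source := mem_extChartAt_source _
    have hd₁ := (contDiffAt_extChartAt_comp (hs₁ t₀) hx).deriv_smooth.continuousAt
    have hd₂ := (contDiffAt_extChartAt_comp (x₀ := c₁ t₀) (hs₂ t₀)
      (by rw [← h0]; exact hx)).deriv_smooth.continuousAt
    refine eventuallyEq_of_geodesic h₁.1 h₂.1 h0 hx ?_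
    by_contra hne
    obtain ⟨t, ht, hne'⟩ := (hfreq.and_eventually
      ((hd₁.ne_iff_eventually_ne hd₂).1 hne)).exists
    refine hne' (Filter.EventuallyEq.deriv_eq ?_)
    filter_upwards [ht] with τ hτ
    rw [hτ]
  have h0 : (0 : ℝ) ∈ {t | c₁ =ᶠ[𝓝 t] c₂} := by
    have hv := h₁.2.trans h₂.2.symm
    have h0 : c₁ 0 = c₂ 0 := congrArg (fun z : TangentBundle (𝓡 n) M => z.1) hv
    have hv' := congrArg (fun z : TangentBundle (𝓡 n) M => (z.2 : EuclideanSpace ℝ (Fin n))) hv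
    simp only [curveVelocity, mfderivWithin_univ] at hv'
    rw [mfderiv_one_eq_deriv ((hs₁ 0).mdifferentiableAt (by simp)),
      mfderiv_one_eq_deriv ((hs₂ 0).mdifferentiableAt (by simp)), ← h0] at hv'
    exact eventuallyEq_of_geodesic h₁.1 h₂.1 h0 (mem_extChartAt_source _) hv'
  have huniv := IsClopen.eq_univ ⟨hclosed, hopen⟩ ⟨0, h0⟩
  funext t
  have : t ∈ {t | c₁ =ᶠ[𝓝 t] c₂} := huniv ▸ mem_univ t
  exact this.self_of_nhds

/-! ### The exponential map -/

theorem isGeodesicFrom_iff (g : SmoothMetric n M) (q : M) (x : TangentSpace (𝓡 n) q) (c : ℝ → M) :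
    g.IsGeodesicFrom q x c ↔ ContMDiff 𝓘(ℝ, ℝ) (𝓡 n) ∞ c ∧ (∀ t, g.GeodesicEqAt c t) ∧ c 0 = q ∧
      (mfderiv 𝓘(ℝ, ℝ) (𝓡 n) c 0 (1 : ℝ) : EuclideanSpace ℝ (Fin n)) = x := by
  have h : ∀ (q' : M) (x' : TangentSpace (𝓡 n) q'),
      (⟨q', x'⟩ : TangentBundle (𝓡 n) M) = ⟨q, x⟩ ↔
        q' = q ∧ (x' : EuclideanSpace ℝ (Fin n)) = x := by
    intro q' x'
    constructor
    · intro h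
      exact ⟨congrArg (fun z : TangentBundle (𝓡 n) M => z.1) h,
        congrArg (fun z : TangentBundle (𝓡 n) M => (z.2 : EuclideanSpace ℝ (Fin n))) h⟩
    · rintro ⟨rfl, h⟩
      exact congrArg (Bundle.TotalSpace.mk q') h
  rw [IsGeodesicFrom, isGeodesicOn_univ_iff, h, curveVelocity, mfderivWithin_univ, and_assoc]

theorem GeodesicEqAt.rescale {g : SmoothMetric n M} {c : ℝ → M} {r t : ℝ}
    (h : g.GeodesicEqAt c (r * t)) : g.GeodesicEqAt (fun τ => c (r * τ)) t := by
  intro x₀ hx e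
  have hy : extChartAt (𝓡 n) x₀ (c (r * t)) ∈ (extChartAt (𝓡 n) x₀).target :=
    (extChartAt (𝓡 n) x₀).map_source hx
  have h1 : deriv (fun τ => extChartAt (𝓡 n) x₀ (c (r * τ))) =
      fun τ => r • deriv (fun τ => extChartAt (𝓡 n) x₀ (c τ)) (r * τ) := by
    funext τ
    exact deriv_comp_mul_left r (fun τ => extChartAt (𝓡 n) x₀ (c τ)) τ
  have h2 : deriv (fun τ => r • deriv (fun τ => extChartAt (𝓡 n) x₀ (c τ)) (r * τ)) t =
      r • r • deriv (deriv fun τ => extChartAt (𝓡 n) x₀ (c τ)) (r * t) := by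
    rw [deriv_fun_const_smul_field]
    rw [deriv_comp_mul_left r (deriv fun τ => extChartAt (𝓡 n) x₀ (c τ)) t]
  have h3 := h x₀ hx e
  rw [h1, h2]
  rw [g.christoffel_eq hy, ← chartForm_apply] at h3 ⊢
  simp only [map_smul, smul_apply, smul_eq_mul] at h3 ⊢
  linear_combination r ^ 2 * h3

theorem IsGeodesicFrom.rescale {g : SmoothMetric n M} {q : M} {x : TangentSpace (𝓡 n) q}
    {c : ℝ → M} (h : g.IsGeodesicFrom q x c) (r : ℝ) :
    g.IsGeodesicFrom q (r • x) (fun t => c (r * t)) := by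
  rw [isGeodesicFrom_iff] at h ⊢
  obtain ⟨hs, hgeo, h0, hv⟩ := h
  have hs' : ContMDiff 𝓘(ℝ, ℝ) (𝓡 n) ∞ (fun t => c (r * t)) :=
    hs.comp (contDiff_const.mul contDiff_id).contMDiff
  refine ⟨hs', fun t => (hgeo _).rescale, by simpa using h0, ?_⟩
  rw [mfderiv_one_eq_deriv ((hs' 0).mdifferentiableAt (by simp))]
  rw [mfderiv_one_eq_deriv ((hs 0).mdifferentiableAt (by simp))] at hv
  rw [deriv_comp_mul_left r (fun τ => extChartAt (𝓡 n) (c (r * 0)) (c τ)) 0, mul_zero, hv]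
  rfl

theorem isGeodesicFrom_const (g : SmoothMetric n M) (q : M) :
    g.IsGeodesicFrom q 0 (fun _ => q) := by
  rw [isGeodesicFrom_iff]
  refine ⟨contMDiff_const, fun t x₀ hx e => ?_, rfl, ?_⟩
  · have hy : extChartAt (𝓡 n) x₀ q ∈ (extChartAt (𝓡 n) x₀).target :=
      (extChartAt (𝓡 n) x₀).map_source hx
    rw [g.christoffel_eq hy, ← chartForm_apply]
    simp
  · rw [mfderiv_const]
    rfl

theorem expMap_eq [T2Space M] {g : SmoothMetric n M} {q : M} {x : TangentSpace (𝓡 n) q}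
    {c : ℝ → M} (h : g.IsGeodesicFrom q x c) : g.expMap q x = c 1 := by
  have hex : ∃ c, g.IsGeodesicFrom q x c := ⟨c, h⟩
  rw [expMap, dif_pos hex, hex.choose_spec.unique h]

theorem expMap_smul [T2Space M] {g : SmoothMetric n M} {q : M} {x : TangentSpace (𝓡 n) q}
    {c : ℝ → M} (h : g.IsGeodesicFrom q x c) (t : ℝ) : g.expMap q (t • x) = c t := by
  rw [expMap_eq (h.rescale t), mul_one]

theorem expMap_zero [T2Space M] (g : SmoothMetric n M) (q : M) :
    g.expMap q (0 : TangentSpace (𝓡 n) q) = q :=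
  expMap_eq (g.isGeodesicFrom_const q)

/-- Where the geodesic with initial velocity `x` does not exist for all times, the exponential map
is constant on the line spanned by `x`. -/
theorem expMap_smul_of_not_exists [T2Space M] {g : SmoothMetric n M} {q : M}
    {x : TangentSpace (𝓡 n) q} (h : ¬ ∃ c, g.IsGeodesicFrom q x c) (t : ℝ) :
    g.expMap q (t • x) = q := by
  rcases eq_or_ne t 0 with rfl | ht
  · rw [zero_smul, expMap_zero]
  · refine dif_neg fun ⟨c, hc⟩ => h ⟨fun τ => c (t⁻¹ * τ), ?_⟩
    have := hc.rescale t⁻¹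
    rwa [smul_smul, inv_mul_cancel₀ ht, one_smul] at this

/-! ### Shears of a metric -/

/-- The bilinear form `(a, b) ↦ a i * b j`. -/
def coordForm (i j : Fin n) : EuclideanSpace ℝ (Fin n) →L[ℝ] EuclideanSpace ℝ (Fin n) →L[ℝ] ℝ :=
  (EuclideanSpace.proj i : EuclideanSpace ℝ (Fin n) →L[ℝ] ℝ).smulRight
    (EuclideanSpace.proj j : EuclideanSpace ℝ (Fin n) →L[ℝ] ℝ)

theorem coordForm_apply (i j : Fin n) (a b : EuclideanSpace ℝ (Fin n)) :
    coordForm i j a b = a i * b j := rfl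

/-- Expansion of a bilinear form on `ℝⁿ` in the forms `coordForm i j`. -/
theorem bilin_eq_sum (T : EuclideanSpace ℝ (Fin n) →L[ℝ] EuclideanSpace ℝ (Fin n) →L[ℝ] ℝ) :
    T = ∑ i, ∑ j, T (EuclideanSpace.single i 1) (EuclideanSpace.single j 1) • coordForm i j := by
  have hx : ∀ x : EuclideanSpace ℝ (Fin n), x = ∑ i, x i • EuclideanSpace.single i (1 : ℝ) := by
    intro x
    have := (EuclideanSpace.basisFun (Fin n) ℝ).sum_repr x
    simpa using this.symm
  ext a b
  conv_lhs => rw [hx a, hx b]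
  simp only [map_sum, map_smul, sum_apply, smul_apply, smul_eq_mul, coordForm_apply,
    Finset.mul_sum]
  rw [Finset.sum_comm]
  refine Finset.sum_congr rfl fun i _ => Finset.sum_congr rfl fun j _ => by ring

/-- Coordinate vector field of the trivialization at `q₀`, with constant coordinates `a`. -/
def frameField (q₀ : M) (a : EuclideanSpace ℝ (Fin n)) (q : M) : TangentSpace (𝓡 n) q :=
  (trivializationAt (EuclideanSpace ℝ (Fin n)) (TangentSpace (𝓡 n) : M → Type _) q₀).symm q a

theorem contMDiffAt_frameField (q₀ : M) (a : EuclideanSpace ℝ (Fin n)) :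
    ContMDiffAt (𝓡 n) (𝓡 n).tangent ∞
      (fun q => (⟨q, frameField q₀ a q⟩ : TangentBundle (𝓡 n) M)) q₀ := by
  refine Bundle.contMDiffAt_totalSpace.2 ⟨contMDiffAt_id, ?_⟩
  refine (contMDiffAt_const (c := a)).congr_of_eventuallyEq ?_
  set e := trivializationAt (EuclideanSpace ℝ (Fin n)) (TangentSpace (𝓡 n) : M → Type _) q₀
  filter_upwards [e.open_baseSet.mem_nhds (FiberBundle.mem_baseSet_trivializationAt' q₀)] with q hq
  exact congrArg Prod.snd (e.apply_mk_symm hq a)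

/-- A field of bilinear forms is smooth once its values on the coordinate fields are. -/
theorem contMDiffAt_bilin {EN HN N : Type*} [NormedAddCommGroup EN] [NormedSpace ℝ EN]
    [TopologicalSpace HN] {IN : ModelWithCorners ℝ EN HN} [TopologicalSpace N] [ChartedSpace HN N]
    {b : N → M} {T : ∀ z : N, TangentSpace (𝓡 n) (b z) →L[ℝ] TangentSpace (𝓡 n) (b z) →L[ℝ] ℝ}
    {z₀ : N} (hb : ContMDiffAt IN (𝓡 n) ∞ b z₀)
    (hT : ∀ a a', ContMDiffAt IN 𝓘(ℝ, ℝ) ∞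
      (fun z => T z (frameField (b z₀) a (b z)) (frameField (b z₀) a' (b z))) z₀) :
    ContMDiffAt IN ((𝓡 n).prod
        𝓘(ℝ, EuclideanSpace ℝ (Fin n) →L[ℝ] EuclideanSpace ℝ (Fin n) →L[ℝ] ℝ)) ∞
      (fun z => Bundle.TotalSpace.mk'
        (EuclideanSpace ℝ (Fin n) →L[ℝ] EuclideanSpace ℝ (Fin n) →L[ℝ] ℝ)
        (E := fun q : M => TangentSpace (𝓡 n) q →L[ℝ] TangentSpace (𝓡 n) q →L[ℝ] ℝ)
        (b z) (T z)) z₀ := by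
  rw [contMDiffAt_hom_bundle]
  refine ⟨hb, ?_⟩
  set e := trivializationAt (EuclideanSpace ℝ (Fin n)) (TangentSpace (𝓡 n) : M → Type _) (b z₀)
    with he
  have hsum : ContMDiffAt IN
      𝓘(ℝ, EuclideanSpace ℝ (Fin n) →L[ℝ] EuclideanSpace ℝ (Fin n) →L[ℝ] ℝ) ∞
      (fun z => ∑ i, ∑ j, T z (frameField (b z₀) (EuclideanSpace.single i 1) (b z))
          (frameField (b z₀) (EuclideanSpace.single j 1) (b z)) • coordForm i j) z₀ :=
    contMDiffAt_finsetSum fun i _ => contMDiffAt_finsetSum fun j _ =>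
      (hT _ _).smul contMDiffAt_const
  refine hsum.congr_of_eventuallyEq ?_
  have hbase : ∀ᶠ z in 𝓝 z₀, b z ∈ e.baseSet :=
    hb.continuousAt.preimage_mem_nhds
      (e.open_baseSet.mem_nhds (FiberBundle.mem_baseSet_trivializationAt' _))
  filter_upwards [hbase] with z hz
  refine (bilin_eq_sum _).trans (Finset.sum_congr rfl fun i _ => Finset.sum_congr rfl fun j _ => ?_)
  congr 1
  refine (inCoordinates_apply_eq₂ (𝕜 := ℝ) (E₁ := (TangentSpace (𝓡 n) : M → Type _))
    (E₂ := (TangentSpace (𝓡 n) : M → Type _)) (E₃ := Bundle.Trivial M ℝ) hz hz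
    (by simp [Bundle.Trivial.fiberBundle_trivializationAt'])).trans ?_
  simp only [Bundle.Trivial.fiberBundle_trivializationAt',
    Bundle.Trivial.linearMapAt_trivialization]
  rfl

/-- A field of endomorphisms preserves smoothness of vector fields. -/
def IsSmoothEndo (A : ∀ q : M, TangentSpace (𝓡 n) q →L[ℝ] TangentSpace (𝓡 n) q) : Prop :=
  ∀ (q₀ : M) (X : ∀ q : M, TangentSpace (𝓡 n) q),
    ContMDiffAt (𝓡 n) (𝓡 n).tangent ∞ (fun q => (⟨q, X q⟩ : TangentBundle (𝓡 n) M)) q₀ →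
    ContMDiffAt (𝓡 n) (𝓡 n).tangent ∞ (fun q => (⟨q, A q (X q)⟩ : TangentBundle (𝓡 n) M)) q₀

/-- The bilinear form `(x, y) ↦ g(x - s A x, y - s A y)`. -/
def shearForm (g : SmoothMetric n M)
    (A : ∀ q : M, TangentSpace (𝓡 n) q →L[ℝ] TangentSpace (𝓡 n) q) (s : ℝ) (q : M) :
    TangentSpace (𝓡 n) q →L[ℝ] TangentSpace (𝓡 n) q →L[ℝ] ℝ :=
  let S := ContinuousLinearMap.id ℝ (TangentSpace (𝓡 n) q) - s • A q
  (ContinuousLinearMap.precomp ℝ S).comp ((g.inner q).comp S)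

theorem shearForm_apply (g : SmoothMetric n M)
    (A : ∀ q : M, TangentSpace (𝓡 n) q →L[ℝ] TangentSpace (𝓡 n) q) (s : ℝ) (q : M)
    (x y : TangentSpace (𝓡 n) q) :
    g.shearForm A s q x y = g.inner q (x - s • A q x) (y - s • A q y) := rfl

/-- The sheared forms depend smoothly on the parameter and the point jointly: their values on
smooth vector fields are polynomials in `s` with smooth coefficients. -/
theorem contMDiff_shearForm (g : SmoothMetric n M)
    {A : ∀ q : M, TangentSpace (𝓡 n) q →L[ℝ] TangentSpace (𝓡 n) q} (hA : IsSmoothEndo A) :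
    ContMDiff (𝓘(ℝ, ℝ).prod (𝓡 n))
      ((𝓡 n).prod 𝓘(ℝ, EuclideanSpace ℝ (Fin n) →L[ℝ] EuclideanSpace ℝ (Fin n) →L[ℝ] ℝ)) ∞
      (fun z : ℝ × M => Bundle.TotalSpace.mk'
        (EuclideanSpace ℝ (Fin n) →L[ℝ] EuclideanSpace ℝ (Fin n) →L[ℝ] ℝ)
        (E := fun q : M => TangentSpace (𝓡 n) q →L[ℝ] TangentSpace (𝓡 n) q →L[ℝ] ℝ)
        z.2 (g.shearForm A z.1 z.2)) := by
  intro z₀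
  refine contMDiffAt_bilin contMDiffAt_snd fun a a' => ?_
  have hX := contMDiffAt_frameField z₀.2 a
  have hX' := contMDiffAt_frameField z₀.2 a'
  have hs : ContMDiffAt (𝓘(ℝ, ℝ).prod (𝓡 n)) 𝓘(ℝ, ℝ) ∞ (fun z : ℝ × M => z.1) z₀ :=
    contMDiffAt_fst
  have pull : ∀ F : M → ℝ, ContMDiffAt (𝓡 n) 𝓘(ℝ, ℝ) ∞ F z₀.2 →
      ContMDiffAt (𝓘(ℝ, ℝ).prod (𝓡 n)) 𝓘(ℝ, ℝ) ∞ (fun z : ℝ × M => F z.2) z₀ :=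
    fun F hF => ContMDiffAt.comp z₀ hF contMDiffAt_snd
  have h1 := pull _ (g.contMDiffAt_inner hX hX')
  have h2 := pull _ (g.contMDiffAt_inner (hA _ _ hX) hX')
  have h3 := pull _ (g.contMDiffAt_inner hX (hA _ _ hX'))
  have h4 := pull _ (g.contMDiffAt_inner (hA _ _ hX) (hA _ _ hX'))
  refine ((h1.sub (hs.mul (h2.add h3))).add ((hs.mul hs).mul h4)).congr_of_eventuallyEq
    (Eventually.of_forall fun z => ?_)
  simp only [shearForm_apply, map_sub, sub_apply, map_smul, smul_apply, smul_eq_mul,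
    Pi.add_apply, Pi.mul_apply]
  ring

/-- The metric obtained from `g` by the shear `x ↦ x - s A x`, for a field `A` of endomorphisms of
square zero. -/
def shear (g : SmoothMetric n M)
    (A : ∀ q : M, TangentSpace (𝓡 n) q →L[ℝ] TangentSpace (𝓡 n) q) (hA : IsSmoothEndo A)
    (hA2 : ∀ q x, A q (A q x) = 0) (s : ℝ) : SmoothMetric n M where
  inner := g.shearForm A s
  symm q x y := g.symm q _ _
  pos q x hx := by
    rw [shearForm_apply]
    refine g.pos q _ fun h0 => hx ?_
    -- `x = s A x` forces `A x = s A (A x) = 0`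
    have h1 : x = s • A q x := sub_eq_zero.1 h0
    have h2 : A q x = 0 := by
      have := congrArg (A q) h1
      rwa [map_smul, hA2, smul_zero] at this
    rw [h1, h2, smul_zero]
  isVonNBounded q := by
    -- the inverse shear `1 + s A` carries the unit ball of `g` onto the new unit ball
    have h := (g.isVonNBounded q).image
      (ContinuousLinearMap.id ℝ (TangentSpace (𝓡 n) q) + s • A q)
    refine h.subset fun x hx => (Set.mem_image _ _ _).2 ⟨x - s • A q x, hx, ?_⟩
    simp [hA2]
  contMDiff := (g.contMDiff_shearForm hA).comp (contMDiff_const.prodMk contMDiff_id)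

theorem shear_inner (g : SmoothMetric n M)
    {A : ∀ q : M, TangentSpace (𝓡 n) q →L[ℝ] TangentSpace (𝓡 n) q} (hA : IsSmoothEndo A)
    (hA2 : ∀ q x, A q (A q x) = 0) (s : ℝ) (q : M) (x y : TangentSpace (𝓡 n) q) :
    (g.shear A hA hA2 s).inner q x y = g.inner q (x - s • A q x) (y - s • A q y) := rfl

theorem shear_inner_of_eq_zero (g : SmoothMetric n M)
    {A : ∀ q : M, TangentSpace (𝓡 n) q →L[ℝ] TangentSpace (𝓡 n) q} (hA : IsSmoothEndo A)
    (hA2 : ∀ q x, A q (A q x) = 0) (s : ℝ) {q : M} (h : A q = 0) :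
    (g.shear A hA hA2 s).inner q = g.inner q := by
  ext x y
  rw [shear_inner, h]
  simp

theorem shear_zero (g : SmoothMetric n M)
    {A : ∀ q : M, TangentSpace (𝓡 n) q →L[ℝ] TangentSpace (𝓡 n) q} (hA : IsSmoothEndo A)
    (hA2 : ∀ q x, A q (A q x) = 0) : g.shear A hA hA2 0 = g := by
  have h : (g.shear A hA hA2 0).inner = g.inner := by
    ext q x y
    rw [shear_inner]
    simp
  revert h
  generalize g.shear A hA hA2 0 = g'
  cases g
  cases g'
  rintro rfl
  rfl

/-! ### Geodesic tubes -/

theorem mfderiv_line {P : Type*} [NormedAddCommGroup P] [NormedSpace ℝ P] {f : P → M}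
    {ℓ : ℝ → P} {a : P} {t : ℝ} (hℓ : HasDerivAt ℓ a t)
    (hf : MDifferentiableAt 𝓘(ℝ, P) (𝓡 n) f (ℓ t)) :
    mfderiv 𝓘(ℝ, ℝ) (𝓡 n) (fun τ => f (ℓ τ)) t (1 : ℝ) = mfderiv 𝓘(ℝ, P) (𝓡 n) f (ℓ t) a := by
  have h := mfderiv_comp_apply t hf hℓ.differentiableAt.mdifferentiableAt (1 : ℝ)
  rw [mfderiv_eq_fderiv] at h
  have h1 : fderiv ℝ ℓ t 1 = a := hℓ.deriv
  exact h.trans (congrArg (mfderiv 𝓘(ℝ, P) (𝓡 n) f (ℓ t)) h1)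

theorem gram_add_right {P : Type*} [NormedAddCommGroup P] [NormedSpace ℝ P] (g : SmoothMetric n M)
    (f : P → M) (a b b' z : P) : g.gram f a (b + b') z = g.gram f a b z + g.gram f a b' z := by
  unfold gram
  have h : mfderiv 𝓘(ℝ, P) (𝓡 n) f z (b + b') =
      mfderiv 𝓘(ℝ, P) (𝓡 n) f z b + mfderiv 𝓘(ℝ, P) (𝓡 n) f z b' :=
    (mfderiv 𝓘(ℝ, P) (𝓡 n) f z).map_add b b'
  exact (congrArg _ h).trans (map_add _ _ _)

theorem gram_smul_right {P : Type*} [NormedAddCommGroup P] [NormedSpace ℝ P] (g : SmoothMetric n M)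
    (f : P → M) (r : ℝ) (a b z : P) : g.gram f a (r • b) z = r * g.gram f a b z := by
  unfold gram
  have h : mfderiv 𝓘(ℝ, P) (𝓡 n) f z (r • b) = r • mfderiv 𝓘(ℝ, P) (𝓡 n) f z b :=
    (mfderiv 𝓘(ℝ, P) (𝓡 n) f z).map_smul r b
  exact (congrArg _ h).trans (map_smul _ _ _)

/-- A map `f` whose lines `t ↦ f (t, y)` are unit speed geodesics, orthogonal at `t = 0` to the
slice `f (0, ·)`. Smoothness is required on a closed time interval around `0` and a ball of radius
`ε`, while each geodesic is defined for all times. -/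
structure IsGeodesicTube {k : ℕ} (g : SmoothMetric n M) (f : ℝ × EuclideanSpace ℝ (Fin k) → M)
    (α β ε : ℝ) : Prop where
  neg : α < 0
  pos : 0 < β
  smooth : ContMDiffOn 𝓘(ℝ, ℝ × EuclideanSpace ℝ (Fin k)) (𝓡 n) ∞ f
    (Icc α β ×ˢ Metric.ball 0 ε)
  geodesic : ∀ y ∈ Metric.ball (0 : EuclideanSpace ℝ (Fin k)) ε,
    g.IsGeodesicOn (fun t => f (t, y)) univ
  speed : ∀ y ∈ Metric.ball (0 : EuclideanSpace ℝ (Fin k)) ε,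
    g.gram (fun t => f (t, y)) (1 : ℝ) 1 0 = 1
  orth : ∀ y ∈ Metric.ball (0 : EuclideanSpace ℝ (Fin k)) ε, ∀ z,
    g.gram f (1, 0) (0, z) (0, y) = 0

namespace IsGeodesicTube

variable {k : ℕ} {g : SmoothMetric n M} {f : ℝ × EuclideanSpace ℝ (Fin k) → M} {α β ε : ℝ}

theorem isOpen_interior :
    IsOpen (Ioo α β ×ˢ Metric.ball (0 : EuclideanSpace ℝ (Fin k)) ε) :=
  isOpen_Ioo.prod Metric.isOpen_ball

theorem interior_subset :
    Ioo α β ×ˢ Metric.ball (0 : EuclideanSpace ℝ (Fin k)) ε ⊆ Icc α β ×ˢ Metric.ball 0 ε :=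
  prod_mono Ioo_subset_Icc_self subset_rfl

theorem contMDiffAt (hf : g.IsGeodesicTube f α β ε) {z : ℝ × EuclideanSpace ℝ (Fin k)}
    (hz : z ∈ Ioo α β ×ˢ Metric.ball 0 ε) :
    ContMDiffAt 𝓘(ℝ, ℝ × EuclideanSpace ℝ (Fin k)) (𝓡 n) ∞ f z :=
  hf.smooth.contMDiffAt (mem_of_superset (isOpen_interior.mem_nhds hz) interior_subset)

theorem hasDerivAt_line (y : EuclideanSpace ℝ (Fin k)) (t : ℝ) :
    HasDerivAt (fun t : ℝ => (t, y)) ((1 : ℝ), (0 : EuclideanSpace ℝ (Fin k))) t :=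
  (hasDerivAt_id t).prodMk (hasDerivAt_const t y)

theorem gram_line (hf : g.IsGeodesicTube f α β ε) {z : ℝ × EuclideanSpace ℝ (Fin k)}
    (hz : z ∈ Ioo α β ×ˢ Metric.ball 0 ε) : g.gram f (1, 0) (1, 0) z = 1 := by
  obtain ⟨t, y⟩ := z
  have h1 := mfderiv_line (hasDerivAt_line y t) ((hf.contMDiffAt hz).mdifferentiableAt (by simp))
  have h2 := (hf.geodesic y hz.2).gram_eq t
  rw [hf.speed y hz.2] at h2
  unfold gram at h2 ⊢
  rw [← h1]
  exact h2

/-- The Gauss lemma for geodesics orthogonal to a hypersurface. -/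
theorem gauss (hf : g.IsGeodesicTube f α β ε) {z : ℝ × EuclideanSpace ℝ (Fin k)}
    (hz : z ∈ Ioo α β ×ˢ Metric.ball 0 ε) (ζ : ℝ × EuclideanSpace ℝ (Fin k)) :
    g.gram f (1, 0) ζ z = ζ.1 := by
  obtain ⟨t, y⟩ := z
  have hT : ∀ {τ : ℝ}, τ ∈ Ioo α β →
      (τ, y) ∈ Ioo α β ×ˢ Metric.ball (0 : EuclideanSpace ℝ (Fin k)) ε := fun hτ => ⟨hτ, hz.2⟩
  have hder : ∀ τ ∈ Ioo α β, HasDerivAt (fun τ => g.gram f (1, 0) ζ (τ, y)) 0 τ := by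
    intro τ hτ
    have hs := hf.contMDiffAt (hT hτ)
    have hd : DifferentiableAt ℝ (g.gram f (1, 0) ζ) (τ, y) :=
      (g.contDiffAt_gram hs _ _).differentiableAt (by simp)
    have h1 := hd.hasFDerivAt.comp_hasDerivAt τ (hasDerivAt_line y τ)
    have hgeo := ((g.isGeodesicOn_univ_iff _).1 (hf.geodesic y hz.2)).2 τ
    have h2 := GeodesicEqAt.fderiv_gram (g := g) (f := f) (hasDerivAt_line y) (t := τ) hs hgeo ζ
    -- the squared speed is constant, so its derivative vanishes
    have h3 : g.gram f (1, 0) (1, 0) =ᶠ[𝓝 (τ, y)] fun _ => 1 := by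
      filter_upwards [isOpen_interior.mem_nhds (hT hτ)] with w hw
      exact hf.gram_line hw
    have h4 : fderiv ℝ (g.gram f (1, 0) ζ) (τ, y) (1, 0) = 0 := by
      rw [h2, h3.fderiv_eq]
      simp
    exact h4 ▸ h1
  have h0 : (0 : ℝ) ∈ Ioo α β := ⟨hf.neg, hf.pos⟩
  have hconst : g.gram f (1, 0) ζ (t, y) = g.gram f (1, 0) ζ (0, y) :=
    isOpen_Ioo.is_const_of_deriv_eq_zero isPreconnected_Ioo
      (fun τ hτ => (hder τ hτ).differentiableAt.differentiableWithinAt)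
      (fun τ hτ => (hder τ hτ).deriv) hz.1 h0
  have hζ : ζ = ζ.1 • ((1 : ℝ), (0 : EuclideanSpace ℝ (Fin k))) + (0, ζ.2) := by
    ext <;> simp
  rw [hconst, hζ, gram_add_right, gram_smul_right, hf.gram_line (hT h0), hf.orth y hz.2]
  simp

/-- A smooth left inverse makes the derivative of `f` injective. -/
theorem mfderiv_injective (hf : g.IsGeodesicTube f α β ε)
    {h : M → ℝ × EuclideanSpace ℝ (Fin k)}
    (hh : ContMDiffOn (𝓡 n) 𝓘(ℝ, ℝ × EuclideanSpace ℝ (Fin k)) ∞ h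
      (f '' (Icc α β ×ˢ Metric.ball 0 ε)))
    (hinv : LeftInvOn h f (Icc α β ×ˢ Metric.ball 0 ε)) {z : ℝ × EuclideanSpace ℝ (Fin k)}
    (hz : z ∈ Ioo α β ×ˢ Metric.ball 0 ε) (ζ : ℝ × EuclideanSpace ℝ (Fin k))
    (hζ : mfderiv 𝓘(ℝ, ℝ × EuclideanSpace ℝ (Fin k)) (𝓡 n) f z ζ = 0) : ζ = 0 := by
  have hzA := interior_subset hz
  have h1 := ((hh _ (mem_image_of_mem f hzA)).mdifferentiableWithinAt (by simp)).hasMFDerivWithinAt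
  have h2 := ((hf.contMDiffAt hz).mdifferentiableAt (by simp)).hasMFDerivAt
  have h3 := h1.comp z (h2.hasMFDerivWithinAt (s := Icc α β ×ˢ Metric.ball 0 ε))
    (fun w hw => mem_image_of_mem f hw)
  have hnhds : Icc α β ×ˢ Metric.ball 0 ε ∈ 𝓝 z :=
    mem_of_superset (isOpen_interior.mem_nhds hz) interior_subset
  have h4 := h3.hasMFDerivAt hnhds
  have h5 : HasMFDerivAt 𝓘(ℝ, ℝ × EuclideanSpace ℝ (Fin k)) 𝓘(ℝ, ℝ × EuclideanSpace ℝ (Fin k))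
      (h ∘ f) z (ContinuousLinearMap.id ℝ _) := by
    refine (hasMFDerivAt_id z).congr_of_eventuallyEq ?_
    filter_upwards [hnhds] with w hw
    exact hinv hw
  have h6 := hasMFDerivAt_unique h4 h5
  have h7 := congrArg (fun φ => φ ζ) h6
  have h8 : mfderivWithin (𝓡 n) 𝓘(ℝ, ℝ × EuclideanSpace ℝ (Fin k)) h
      (f '' (Icc α β ×ˢ Metric.ball 0 ε)) (f z)
      (mfderiv 𝓘(ℝ, ℝ × EuclideanSpace ℝ (Fin k)) (𝓡 n) f z ζ) = ζ := h7
  rw [hζ, map_zero] at h8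
  exact h8.symm

/-- By the inverse function theorem, a map with injective derivative between spaces of the same
dimension is open. -/
theorem image_mem_nhds {P : Type*} [NormedAddCommGroup P] [NormedSpace ℝ P]
    [FiniteDimensional ℝ P] (hP : Module.finrank ℝ P = n) {f : P → M} {z : P}
    (hf : ContMDiffAt 𝓘(ℝ, P) (𝓡 n) ∞ f z)
    (hinj : ∀ ζ : P, mfderiv 𝓘(ℝ, P) (𝓡 n) f z ζ = 0 → ζ = 0) {U : Set P} (hU : U ∈ 𝓝 z) :
    f '' U ∈ 𝓝 (f z) := by
  have hx : f z ∈ (extChartAt (𝓡 n) (f z)).source := mem_extChartAt_source _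
  have hs := contDiffAt_extChartAt_comp hf hx
  have hinj' : Function.Injective (fderiv ℝ (fun w => extChartAt (𝓡 n) (f z) (f w)) z) := by
    refine (injective_iff_map_eq_zero _).2 fun ζ hζ => hinj ζ ?_
    rw [← mfderiv_extChartAt_symm_comp (hf.mdifferentiableAt (by simp)) hx ζ, hζ]
    exact map_zero _
  have hsurj : Function.Surjective (fderiv ℝ (fun w => extChartAt (𝓡 n) (f z) (f w)) z) :=
    (LinearMap.injective_iff_surjective_of_finrank_eq_finrank
      (f := (fderiv ℝ (fun w => extChartAt (𝓡 n) (f z) (f w)) z).toLinearMap)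
      (by simp [hP])).1 hinj'
  have hmap := (hs.hasStrictFDerivAt (by simp)).map_nhds_eq_of_surj
    (LinearMap.range_eq_top.2 hsurj)
  have hV : U ∩ f ⁻¹' (extChartAt (𝓡 n) (f z)).source ∈ 𝓝 z :=
    inter_mem hU (hf.continuousAt.preimage_mem_nhds ((isOpen_extChartAt_source _).mem_nhds hx))
  have h1 := image_mem_map (m := fun w => extChartAt (𝓡 n) (f z) (f w)) hV
  rw [hmap] at h1
  filter_upwards [(continuousAt_extChartAt (I := 𝓡 n) (f z)).preimage_mem_nhds h1,
    (isOpen_extChartAt_source (I := 𝓡 n) (f z)).mem_nhds hx] with q hq1 hq2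
  obtain ⟨w, hw, hwq⟩ := hq1
  exact ⟨w, hw.1, (extChartAt (𝓡 n) (f z)).injOn hw.2 hq2 hwq⟩

end IsGeodesicTube

/-! ### Shearing along a geodesic tube -/

section Field

variable {P : Type*} [NormedAddCommGroup P] [NormedSpace ℝ P]

/-- The coordinate field `∂_a f` as a vector field on `M`, for a map `f` with left inverse `h`;
meaningful on the image of `f`. -/
def pushField (f : P → M) (h : M → P) (a : P) (q : M) : TangentSpace (𝓡 n) q :=
  (mfderiv 𝓘(ℝ, P) (𝓡 n) f (h q) a : EuclideanSpace ℝ (Fin n))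

theorem pushField_apply {f : P → M} {h : M → P} {z : P} (hz : h (f z) = z) (a : P) :
    pushField (n := n) f h a (f z) = mfderiv 𝓘(ℝ, P) (𝓡 n) f z a := by
  have : ∀ z', z' = z → (mfderiv 𝓘(ℝ, P) (𝓡 n) f z' a : EuclideanSpace ℝ (Fin n)) =
      mfderiv 𝓘(ℝ, P) (𝓡 n) f z a := by
    rintro _ rfl
    rfl
  exact this _ hz

theorem contMDiffAt_pushField {f : P → M} {h : M → P} {z : P}
    (hf : ContMDiffAt 𝓘(ℝ, P) (𝓡 n) ∞ f z) (hh : ContMDiffAt (𝓡 n) 𝓘(ℝ, P) ∞ h (f z))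
    (hz : h (f z) = z) (hinv : ∀ᶠ q in 𝓝 (f z), f (h q) = q) (a : P) :
    ContMDiffAt (𝓡 n) (𝓡 n).tangent ∞
      (fun q => (⟨q, pushField f h a q⟩ : TangentBundle (𝓡 n) M)) (f z) := by
  have h1 := contMDiffAt_mfderiv_apply (hz.symm ▸ hf : ContMDiffAt 𝓘(ℝ, P) (𝓡 n) ∞ f (h (f z))) a
  refine (ContMDiffAt.comp (f z) h1 hh).congr_of_eventuallyEq ?_
  filter_upwards [hinv] with q hq
  have : ∀ q', q' = q → (⟨q, pushField f h a q⟩ : TangentBundle (𝓡 n) M) =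
      ⟨q', (mfderiv 𝓘(ℝ, P) (𝓡 n) f (h q) a : EuclideanSpace ℝ (Fin n))⟩ := by
    rintro _ rfl
    rfl
  exact this _ hq

open Classical in
/-- The field of endomorphisms `φ g(∂_a f, ·) ⊗ ∂_b f`, where the function `φ` on the parameter
domain of `f` is supported in `K`. -/
def tubeEndo (g : SmoothMetric n M) (f : P → M) (h : M → P) (a b : P) (φ : P → ℝ) (K : Set P)
    (q : M) : TangentSpace (𝓡 n) q →L[ℝ] TangentSpace (𝓡 n) q :=
  ((if q ∈ f '' K then φ (h q) else 0) • g.inner q (pushField f h a q)).smulRight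
    (pushField f h b q)

theorem tubeEndo_of_notMem (g : SmoothMetric n M) {f : P → M} {h : M → P} {a b : P} {φ : P → ℝ}
    {K : Set P} {q : M} (hq : q ∉ f '' K) : g.tubeEndo f h a b φ K q = 0 := by
  ext x
  simp [tubeEndo, if_neg hq]

theorem tubeEndo_apply (g : SmoothMetric n M) {f : P → M} {h : M → P} {a b : P} {φ : P → ℝ}
    {K T : Set P} (hinv : LeftInvOn h f T) (hK : K ⊆ T) (hφ : ∀ z, z ∉ K → φ z = 0) {z : P}
    (hz : z ∈ T) (x : TangentSpace (𝓡 n) (f z)) :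
    g.tubeEndo f h a b φ K (f z) x =
      (φ z * g.inner (f z) (mfderiv 𝓘(ℝ, P) (𝓡 n) f z a) x) •
        mfderiv 𝓘(ℝ, P) (𝓡 n) f z b := by
  classical
  have hφz : (if f z ∈ f '' K then φ (h (f z)) else 0) = φ z := by
    by_cases hzK : z ∈ K
    · rw [if_pos (mem_image_of_mem f hzK), hinv hz]
    · rw [if_neg, hφ z hzK]
      rintro ⟨w, hw, hwz⟩
      exact hzK (hinv.injOn (hK hw) hz hwz ▸ hw)
  unfold tubeEndo
  rw [hφz, pushField_apply (hinv hz), pushField_apply (hinv hz)]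
  rfl

end Field

namespace IsGeodesicTube

variable {k : ℕ} {g : SmoothMetric n M} {f : ℝ × EuclideanSpace ℝ (Fin k) → M} {α β ε : ℝ}
  {h : M → ℝ × EuclideanSpace ℝ (Fin k)} {φ : ℝ × EuclideanSpace ℝ (Fin k) → ℝ}
  {K : Set (ℝ × EuclideanSpace ℝ (Fin k))} {w : EuclideanSpace ℝ (Fin k)}

theorem finrank_eq (hk : k + 1 = n) : Module.finrank ℝ (ℝ × EuclideanSpace ℝ (Fin k)) = n := by
  rw [Module.finrank_prod]
  simp
  omega

/-- `∂_w f` is orthogonal to `∂_t f` by the Gauss lemma, so the endomorphisms have square zero. -/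
theorem tubeEndo_sq (hf : g.IsGeodesicTube f α β ε)
    (hinv : LeftInvOn h f (Icc α β ×ˢ Metric.ball 0 ε)) (hK : K ⊆ Ioo α β ×ˢ Metric.ball 0 ε)
    (hφ : ∀ z, z ∉ K → φ z = 0) (q : M) (x : TangentSpace (𝓡 n) q) :
    g.tubeEndo f h (1, 0) (0, w) φ K q (g.tubeEndo f h (1, 0) (0, w) φ K q x) = 0 := by
  by_cases hq : q ∈ f '' K
  · obtain ⟨z, hz, rfl⟩ := hq
    have hinv' := hinv.mono interior_subset
    have h1 := hf.gauss (hK hz) (0, w)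
    unfold gram at h1
    rw [g.tubeEndo_apply hinv' hK hφ (hK hz), g.tubeEndo_apply hinv' hK hφ (hK hz), map_smul,
      h1]
    simp
  · rw [g.tubeEndo_of_notMem hq]
    rfl

/-- The endomorphisms are smooth around the image of the compact set `K`, where `f` is a
diffeomorphism, and vanish off this closed image. -/
theorem isSmoothEndo_tubeEndo [T2Space M] (hk : k + 1 = n) (hf : g.IsGeodesicTube f α β ε)
    (hh : ContMDiffOn (𝓡 n) 𝓘(ℝ, ℝ × EuclideanSpace ℝ (Fin k)) ∞ h
      (f '' (Icc α β ×ˢ Metric.ball 0 ε)))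
    (hinv : LeftInvOn h f (Icc α β ×ˢ Metric.ball 0 ε)) (hKc : IsCompact K)
    (hK : K ⊆ Ioo α β ×ˢ Metric.ball 0 ε) (hφ : ∀ z, z ∉ K → φ z = 0) (hφs : ContDiff ℝ ∞ φ) :
    IsSmoothEndo (g.tubeEndo f h (1, 0) (0, w) φ K) := by
  intro q₀ X hX
  by_cases hq : q₀ ∈ f '' K
  · obtain ⟨z, hzK, rfl⟩ := hq
    have hz := hK hzK
    have hfz := hf.contMDiffAt hz
    have hU : f '' (Ioo α β ×ˢ Metric.ball 0 ε) ∈ 𝓝 (f z) :=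
      image_mem_nhds (finrank_eq hk) hfz (hf.mfderiv_injective hh hinv hz)
        (isOpen_interior.mem_nhds hz)
    have hhz : ContMDiffAt (𝓡 n) 𝓘(ℝ, ℝ × EuclideanSpace ℝ (Fin k)) ∞ h (f z) :=
      hh.contMDiffAt (mem_of_superset hU (image_mono interior_subset))
    have hinv' : ∀ᶠ q in 𝓝 (f z), f (h q) = q := by
      filter_upwards [hU] with q hq
      obtain ⟨z', hz', rfl⟩ := hq
      rw [hinv (interior_subset hz')]
    have hN := contMDiffAt_pushField hfz hhz (hinv (interior_subset hz)) hinv' (1, 0)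
    have hW := contMDiffAt_pushField hfz hhz (hinv (interior_subset hz)) hinv' (0, w)
    have hφh : ContMDiffAt (𝓡 n) 𝓘(ℝ, ℝ) ∞ (fun q => φ (h q)) (f z) :=
      ContMDiffAt.comp (f z) hφs.contDiffAt.contMDiffAt hhz
    refine ContMDiffAt.congr_of_eventuallyEq
      (ContMDiffAt.smul_section (hφh.mul (g.contMDiffAt_inner hN hX)) hW) ?_
    filter_upwards [hU] with q hq
    obtain ⟨z', hz', rfl⟩ := hq
    have hi : h (f z') = z' := hinv (interior_subset hz')
    congr 1
    rw [g.tubeEndo_apply (hinv.mono interior_subset) hK hφ hz']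
    change _ = (φ (h (f z')) * g.inner (f z') (pushField f h (1, 0) (f z')) (X (f z'))) •
      pushField f h (0, w) (f z')
    rw [pushField_apply hi, pushField_apply hi, hi]
  · have hclosed : IsClosed (f '' K) :=
      (hKc.image_of_continuousOn fun z hz =>
        (hf.contMDiffAt (hK hz)).continuousAt.continuousWithinAt).isClosed
    refine ContMDiffAt.congr_of_eventuallyEq
      (Bundle.contMDiff_zeroSection ℝ (TangentSpace (𝓡 n) : M → Type _)).contMDiffAt ?_
    filter_upwards [hclosed.isOpen_compl.mem_nhds hq] with q hq'
    rw [g.tubeEndo_of_notMem hq']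
    rfl

/-- Bending the geodesics of the tube: for the sheared metric, the curve `t ↦ f (t, σ t w)` is a
unit speed geodesic as soon as the shear has the same slope as the curve near it. -/
theorem geodesicEqAt_shear (hk : k + 1 = n) (hf : g.IsGeodesicTube f α β ε)
    (hh : ContMDiffOn (𝓡 n) 𝓘(ℝ, ℝ × EuclideanSpace ℝ (Fin k)) ∞ h
      (f '' (Icc α β ×ˢ Metric.ball 0 ε)))
    (hinv : LeftInvOn h f (Icc α β ×ˢ Metric.ball 0 ε))
    (hK : K ⊆ Ioo α β ×ˢ Metric.ball 0 ε) (hφ : ∀ z, z ∉ K → φ z = 0)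
    (hA : IsSmoothEndo (g.tubeEndo f h (1, 0) (0, w) φ K))
    (hA2 : ∀ q x, g.tubeEndo f h (1, 0) (0, w) φ K q (g.tubeEndo f h (1, 0) (0, w) φ K q x) = 0)
    {s : ℝ} {σ : ℝ → ℝ} (hσ : ContDiff ℝ ∞ σ) {t₀ : ℝ}
    (ht₀ : (t₀, σ t₀ • w) ∈ Ioo α β ×ˢ Metric.ball 0 ε)
    (hslope : ∀ᶠ z in 𝓝 (t₀, σ t₀ • w), s * φ z = deriv σ z.1) :
    (g.shear _ hA hA2 s).GeodesicEqAt (fun t => f (t, σ t • w)) t₀ ∧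
      (g.shear _ hA hA2 s).gram (fun t => f (t, σ t • w)) (1 : ℝ) 1 t₀ = 1 := by
  -- `Θ` straightens the curve, and `f ∘ Θ` has the Gram coefficients of a geodesic tube
  set Θ : ℝ × EuclideanSpace ℝ (Fin k) → ℝ × EuclideanSpace ℝ (Fin k) :=
    fun z => (z.1, z.2 + σ z.1 • w) with hΘ
  set G := g.shear _ hA hA2 s with hG
  have hΘs : ContDiff ℝ ∞ Θ :=
    contDiff_fst.prodMk (contDiff_snd.add ((hσ.comp contDiff_fst).smul contDiff_const))
  have hΘ0 : Θ (t₀, 0) = (t₀, σ t₀ • w) := by simp [hΘ]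
  have hΘd : ∀ z ζ, fderiv ℝ Θ z ζ = (ζ.1, ζ.2 + (deriv σ z.1 * ζ.1) • w) := by
    intro z ζ
    have h0 : HasFDerivAt (fun z : ℝ × EuclideanSpace ℝ (Fin k) => z.1)
        (ContinuousLinearMap.fst ℝ ℝ (EuclideanSpace ℝ (Fin k))) z := hasFDerivAt_fst
    have h1 : HasFDerivAt (fun z : ℝ × EuclideanSpace ℝ (Fin k) => σ z.1) _ z :=
      ((hσ.differentiable (by simp)) z.1).hasDerivAt.comp_hasFDerivAt z h0
    have h2 : HasFDerivAt Θ _ z :=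
      hasFDerivAt_fst.prodMk (hasFDerivAt_snd.add (h1.smul_const w))
    rw [h2.fderiv]
    simp
  have hT : ∀ᶠ z in 𝓝 ((t₀, 0) : ℝ × EuclideanSpace ℝ (Fin k)),
      Θ z ∈ Ioo α β ×ˢ Metric.ball 0 ε ∧ s * φ (Θ z) = deriv σ z.1 := by
    have hc : Tendsto Θ (𝓝 (t₀, 0)) (𝓝 (t₀, σ t₀ • w)) := hΘ0 ▸ hΘs.continuous.continuousAt
    exact (hc.eventually (isOpen_interior.mem_nhds ht₀)).and (hc.eventually hslope)
  have hmf : ∀ z, Θ z ∈ Ioo α β ×ˢ Metric.ball 0 ε → ∀ ζ,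
      mfderiv 𝓘(ℝ, ℝ × EuclideanSpace ℝ (Fin k)) (𝓡 n) (fun z => f (Θ z)) z ζ =
      mfderiv 𝓘(ℝ, ℝ × EuclideanSpace ℝ (Fin k)) (𝓡 n) f (Θ z)
        (ζ.1, ζ.2 + (deriv σ z.1 * ζ.1) • w) := by
    intro z hz ζ
    have h1 := mfderiv_comp_apply z ((hf.contMDiffAt hz).mdifferentiableAt (by simp))
      ((hΘs.differentiable (by simp)) z).mdifferentiableAt ζ
    rw [mfderiv_eq_fderiv] at h1
    exact h1.trans (congrArg _ (hΘd z ζ))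
  have hgram : ∀ z, Θ z ∈ Ioo α β ×ˢ Metric.ball 0 ε → s * φ (Θ z) = deriv σ z.1 → ∀ ζ,
      G.gram (fun z => f (Θ z)) (1, 0) ζ z = ζ.1 := by
    intro z hz hs ζ
    -- the shear takes `∂_ζ (f ∘ Θ)` to `∂_ζ f`
    have key : ∀ ζ : ℝ × EuclideanSpace ℝ (Fin k),
        mfderiv 𝓘(ℝ, ℝ × EuclideanSpace ℝ (Fin k)) (𝓡 n) (fun z => f (Θ z)) z ζ -
          s • g.tubeEndo f h (1, 0) (0, w) φ K (f (Θ z))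
            (mfderiv 𝓘(ℝ, ℝ × EuclideanSpace ℝ (Fin k)) (𝓡 n) (fun z => f (Θ z)) z ζ) =
        mfderiv 𝓘(ℝ, ℝ × EuclideanSpace ℝ (Fin k)) (𝓡 n) f (Θ z) ζ := by
      intro ζ
      have h1 := hf.gauss hz (ζ.1, ζ.2 + (deriv σ z.1 * ζ.1) • w)
      unfold gram at h1
      rw [hmf z hz ζ, g.tubeEndo_apply (hinv.mono interior_subset) hK hφ hz, h1, smul_smul,
        ← mul_assoc, hs]
      obtain ⟨L, hL⟩ : ∃ L : ℝ × EuclideanSpace ℝ (Fin k) →L[ℝ] EuclideanSpace ℝ (Fin n),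
        L = mfderiv 𝓘(ℝ, ℝ × EuclideanSpace ℝ (Fin k)) (𝓡 n) f (Θ z) := ⟨_, rfl⟩
      rw [← hL]
      change L _ - (deriv σ z.1 * ζ.1) • L (0, w) = L ζ
      rw [← L.map_smul, ← map_sub]
      congr 1
      ext <;> simp
    have h2 := hf.gauss hz ζ
    unfold gram at h2 ⊢
    rw [hG, shear_inner, key, key]
    exact h2
  have hdim := finrank_eq hk
  have hline := hasDerivAt_line (0 : EuclideanSpace ℝ (Fin k))
  have hfΘ : ContMDiffAt 𝓘(ℝ, ℝ × EuclideanSpace ℝ (Fin k)) (𝓡 n) ∞ (fun z => f (Θ z)) (t₀, 0) :=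
    ContMDiffAt.comp _ (hf.contMDiffAt (hΘ0 ▸ ht₀)) hΘs.contDiffAt.contMDiffAt
  have hcurve : (fun t => f (t, σ t • w)) = fun t => f (Θ (t, 0)) := by
    funext t
    simp [hΘ]
  rw [hcurve]
  obtain ⟨hT0, hs0⟩ := hT.self_of_nhds
  constructor
  · refine geodesicEqAt_of_fderiv_gram (f := fun z => f (Θ z)) hdim hline hfΘ ?_ fun ζ => ?_
    · intro ζ hζ
      have h1 := hf.mfderiv_injective hh hinv hT0 _ ((hmf _ hT0 ζ).symm.trans hζ)
      have h2 : ζ.1 = 0 := congrArg Prod.fst h1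
      have h3 := congrArg Prod.snd h1
      simp only [h2, mul_zero, zero_smul, add_zero, Prod.snd_zero] at h3
      exact Prod.ext h2 h3
    · have hev : ∀ ζ : ℝ × EuclideanSpace ℝ (Fin k),
          G.gram (fun z => f (Θ z)) (1, 0) ζ =ᶠ[𝓝 (t₀, 0)] fun _ => ζ.1 := by
        intro ζ
        filter_upwards [hT] with z hz
        exact hgram z hz.1 hz.2 ζ
      rw [(hev ζ).fderiv_eq, (hev (1, 0)).fderiv_eq]
      simp
  · have h1 := mfderiv_line (hline t₀) (hfΘ.mdifferentiableAt (by simp))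
    have h2 := hgram _ hT0 hs0 (1, 0)
    unfold gram at h2 ⊢
    rw [h1]
    exact h2

end IsGeodesicTube

/-! ### The normal exponential coordinates -/

/-- Vectors at equal points may be compared in the model space, where tangent spaces coincide. -/
theorem inner_congr (g : SmoothMetric n M) {q q' : M} (hq : q = q')
    {a b : TangentSpace (𝓡 n) q} {a' b' : TangentSpace (𝓡 n) q'}
    (ha : (a : EuclideanSpace ℝ (Fin n)) = a') (hb : (b : EuclideanSpace ℝ (Fin n)) = b') :
    g.inner q a b = g.inner q' a' b' := by
  subst hq
  have ha' : a = a' := ha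
  have hb' : b = b' := hb
  rw [ha', hb']

/-- The squared speed of a curve on an interval, computed from a curve which agrees with it near
the time considered. -/
theorem inner_curveVelocity (g : SmoothMetric n M) {c γ : ℝ → M} {a b t : ℝ} (hab : a < b)
    (ht : t ∈ Icc a b) (hγ : MDifferentiableAt 𝓘(ℝ, ℝ) (𝓡 n) γ t) (heq : c =ᶠ[𝓝[Icc a b] t] γ) :
    g.inner (c t) (curveVelocity n c (Icc a b) t) (curveVelocity n c (Icc a b) t) =
      g.gram γ 1 1 t := by
  have h0 : c t = γ t := heq.self_of_nhdsWithin ht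
  have hu : UniqueMDiffWithinAt 𝓘(ℝ, ℝ) (Icc a b) t :=
    (uniqueDiffOn_Icc hab t ht).uniqueMDiffWithinAt
  have h1 : (mfderivWithin 𝓘(ℝ, ℝ) (𝓡 n) c (Icc a b) t : ℝ →L[ℝ] EuclideanSpace ℝ (Fin n)) =
      mfderiv 𝓘(ℝ, ℝ) (𝓡 n) γ t :=
    (heq.mfderivWithin_eq h0).trans (mfderivWithin_eq_mfderiv hu hγ)
  have h2 : (curveVelocity n c (Icc a b) t : EuclideanSpace ℝ (Fin n)) =
      mfderiv 𝓘(ℝ, ℝ) (𝓡 n) γ t (1 : ℝ) :=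
    congrArg (fun φ : ℝ →L[ℝ] EuclideanSpace ℝ (Fin n) => φ 1) h1
  exact g.inner_congr h0 h2 h2

theorem curveLength_of_unit_speed (g : SmoothMetric n M) {c : ℝ → M} {a b : ℝ} (hab : a ≤ b)
    (h : ∀ t ∈ Icc a b, g.inner (c t) (curveVelocity n c (Icc a b) t)
      (curveVelocity n c (Icc a b) t) = 1) : g.curveLength c a b = b - a := by
  unfold curveLength
  rw [intervalIntegral.integral_congr (g := fun _ => (1 : ℝ))]
  · simp
  · intro t ht
    rw [uIcc_of_le hab] at ht
    simp [h t ht]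

section Tube

variable {k : ℕ} {g : SmoothMetric n M} {p : M} {v : TangentSpace (𝓡 n) p}
  {ζ : g.normalSpace p v ≃ₗ[ℝ] EuclideanSpace ℝ (Fin k)} {ν : (q : M) → TangentSpace (𝓡 n) q}
  {η ε : ℝ}

theorem tubeMap_apply (t : ℝ) (y : EuclideanSpace ℝ (Fin k)) :
    g.tubeMap p v ζ ν (t, y) = g.expMap (g.slice p v ζ y) (t • ν (g.slice p v ζ y)) := rfl

theorem tubeMap_zero_left [T2Space M] (y : EuclideanSpace ℝ (Fin k)) :
    g.tubeMap p v ζ ν (0, y) = g.slice p v ζ y := by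
  rw [tubeMap_apply, zero_smul, expMap_zero]

theorem slice_zero [T2Space M] : g.slice p v ζ 0 = p := by
  unfold slice
  rw [map_zero]
  exact g.expMap_zero p

theorem tubeMap_zero_right [T2Space M] (hν : ν p = v) (t : ℝ) :
    g.tubeMap p v ζ ν (t, 0) = g.expMap p (t • v) := by
  rw [tubeMap_apply, slice_zero, hν]

/-- Injectivity of the tube map forces the geodesics normal to the slice to exist for all times:
otherwise the tube map would be constant on the corresponding line. -/
theorem isGeodesicFrom_tubeMap [T2Space M] (hη : 0 < η)
    (hinj : InjOn (g.tubeMap p v ζ ν) (Icc (-2 * η) (2 * η) ×ˢ Metric.ball 0 ε))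
    {y : EuclideanSpace ℝ (Fin k)} (hy : y ∈ Metric.ball 0 ε) :
    g.IsGeodesicFrom (g.slice p v ζ y) (ν (g.slice p v ζ y))
      (fun t => g.tubeMap p v ζ ν (t, y)) := by
  by_cases hex : ∃ c, g.IsGeodesicFrom (g.slice p v ζ y) (ν (g.slice p v ζ y)) c
  · obtain ⟨c, hc⟩ := hex
    have : (fun t => g.tubeMap p v ζ ν (t, y)) = c := by
      funext t
      rw [tubeMap_apply, expMap_smul hc]
    rwa [this]
  · have h1 : g.tubeMap p v ζ ν (0, y) = g.tubeMap p v ζ ν (η, y) := by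
      rw [tubeMap_apply, tubeMap_apply, expMap_smul_of_not_exists hex,
        expMap_smul_of_not_exists hex]
    have h2 := hinj (mk_mem_prod (mem_Icc.2 ⟨by linarith, by linarith⟩) hy)
      (mk_mem_prod (mem_Icc.2 ⟨by linarith, by linarith⟩) hy) h1
    exact absurd (congrArg Prod.fst h2) hη.ne

/-- The normal exponential coordinates of a hypersurface form a geodesic tube. -/
theorem isGeodesicTube_tubeMap [T2Space M] (hη : 0 < η) (hν : g.IsUnitNormalField p v ζ ε ν)
    (hξ : IsDiffeoOntoImage (n := n) (g.tubeMap p v ζ ν)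
      (Icc (-2 * η) (2 * η) ×ˢ Metric.ball 0 ε)) :
    g.IsGeodesicTube (g.tubeMap p v ζ ν) (-2 * η) (2 * η) ε := by
  obtain ⟨hs, h, -, hinv⟩ := hξ
  have hgeo : ∀ y ∈ Metric.ball (0 : EuclideanSpace ℝ (Fin k)) ε, _ := fun y hy =>
    isGeodesicFrom_tubeMap (ν := ν) (ζ := ζ) hη hinv.injOn hy
  have hvel : ∀ y ∈ Metric.ball (0 : EuclideanSpace ℝ (Fin k)) ε,
      (mfderiv 𝓘(ℝ, ℝ) (𝓡 n) (fun t => g.tubeMap p v ζ ν (t, y)) 0 (1 : ℝ) :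
        EuclideanSpace ℝ (Fin n)) = ν (g.slice p v ζ y) := fun y hy =>
    ((g.isGeodesicFrom_iff _ _ _).1 (hgeo y hy)).2.2.2
  refine ⟨by linarith, by linarith, hs, fun y hy => (hgeo y hy).1, fun y hy => ?_,
    fun y hy z => ?_⟩
  · exact (g.inner_congr (tubeMap_zero_left y) (hvel y hy) (hvel y hy)).trans (hν.2.1 y hy).1
  · have hz : ((0 : ℝ), y) ∈ Ioo (-2 * η) (2 * η) ×ˢ Metric.ball 0 ε :=
      ⟨mem_Ioo.2 ⟨by linarith, by linarith⟩, hy⟩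
    have hd : MDifferentiableAt 𝓘(ℝ, ℝ × EuclideanSpace ℝ (Fin k)) (𝓡 n) (g.tubeMap p v ζ ν)
        (0, y) :=
      (hs.contMDiffAt (mem_of_superset (IsGeodesicTube.isOpen_interior.mem_nhds hz)
        IsGeodesicTube.interior_subset)).mdifferentiableAt (by simp)
    refine (g.inner_congr (tubeMap_zero_left y) ?_ ?_).trans ((hν.2.1 y hy).2 z)
    · rw [← hvel y hy]
      exact (mfderiv_line (IsGeodesicTube.hasDerivAt_line y 0) hd).symm
    · have hslice : g.slice p v ζ = g.tubeMap p v ζ ν ∘ fun y => (0, y) := by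
        funext y
        exact (tubeMap_zero_left y).symm
      have hι : HasFDerivAt (fun y : EuclideanSpace ℝ (Fin k) => ((0 : ℝ), y))
          (ContinuousLinearMap.inr ℝ ℝ (EuclideanSpace ℝ (Fin k))) y :=
        (hasFDerivAt_const (0 : ℝ) y).prodMk (hasFDerivAt_id y)
      have h1 := mfderiv_comp_apply y hd hι.differentiableAt.mdifferentiableAt z
      rw [mfderiv_eq_fderiv] at h1
      have h2 : fderiv ℝ (fun y : EuclideanSpace ℝ (Fin k) => ((0 : ℝ), y)) y z = (0, z) := by
        rw [hι.fderiv]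
        rfl
      rw [hslice]
      exact (h1.trans (congrArg (mfderiv 𝓘(ℝ, ℝ × EuclideanSpace ℝ (Fin k)) (𝓡 n)
        (g.tubeMap p v ζ ν) (0, y)) h2)).symm

theorem symm_mem_normalBall (hζ : g.IsNormalIsometry p v ζ) {y : EuclideanSpace ℝ (Fin k)}
    (hy : y ∈ Metric.ball 0 ε) :
    (ζ.symm y : TangentSpace (𝓡 n) p) ∈ g.normalBall p v ε := by
  refine ⟨(ζ.symm y).2, ?_⟩
  have h := hζ (ζ.symm y) (ζ.symm y)
  rw [LinearEquiv.apply_symm_apply, real_inner_self_eq_norm_sq] at h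
  rw [← h, Real.sqrt_sq (norm_nonneg _)]
  simpa using hy

end Tube

/-! ### Moving the axis of a tube -/

/-- The parameters `(t, y)` with `a ≤ |t| ≤ b` and `‖y‖ ≤ r`, outside which the metric is not
changed. -/
def transitionSet (k : ℕ) (a b r : ℝ) : Set (ℝ × EuclideanSpace ℝ (Fin k)) :=
  (Icc (-b) (-a) ∪ Icc a b) ×ˢ Metric.closedBall 0 r

theorem isCompact_transitionSet (k : ℕ) (a b r : ℝ) : IsCompact (transitionSet k a b r) :=
  (isCompact_Icc.union isCompact_Icc).prod (isCompact_closedBall 0 r)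

/-- The slope of the profile, cut off by a bump function, is supported in the transition set. -/
theorem deriv_mul_bump_eq_zero {k : ℕ} {ρ : ℝ → ℝ} {a b : ℝ} (hρ1 : ∀ t, |t| ≤ a → ρ t = 1)
    (hρ0 : ∀ t, b ≤ |t| → ρ t = 0) (ψ : ContDiffBump (0 : EuclideanSpace ℝ (Fin k)))
    {z : ℝ × EuclideanSpace ℝ (Fin k)} (hz : z ∉ transitionSet k a b ψ.rOut) :
    deriv ρ z.1 * ψ z.2 = 0 := by
  by_cases h2 : z.2 ∈ Metric.closedBall 0 ψ.rOut
  · have h1 : z.1 ∉ Icc (-b) (-a) ∪ Icc a b := fun h => hz ⟨h, h2⟩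
    have h3 : |z.1| < a ∨ b < |z.1| := by
      by_contra! hcon
      refine h1 ?_
      rcases abs_cases z.1 with ⟨h, -⟩ | ⟨h, -⟩
      · exact Or.inr ⟨by linarith, by linarith⟩
      · exact Or.inl ⟨by linarith, by linarith⟩
    have h4 : deriv ρ z.1 = 0 := by
      rcases h3 with h3 | h3
      · have : ρ =ᶠ[𝓝 z.1] fun _ => 1 := by
          filter_upwards [continuous_abs.continuousAt.preimage_mem_nhds (Iio_mem_nhds h3)] with t ht
          exact hρ1 t (mem_Iio.1 ht).le
        rw [this.deriv_eq, deriv_const]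
      · have : ρ =ᶠ[𝓝 z.1] fun _ => 0 := by
          filter_upwards [continuous_abs.continuousAt.preimage_mem_nhds (Ioi_mem_nhds h3)] with t ht
          exact hρ0 t (mem_Ioi.1 ht).le
        rw [this.deriv_eq, deriv_const]
    rw [h4, zero_mul]
  · rw [ψ.zero_of_le_dist, mul_zero]
    exact (not_le.1 fun h => h2 (Metric.mem_closedBall.2 h)).le

end SmoothMetric

/-- An even smooth profile, equal to `1` on `[-a, a]`, to `0` outside `[-b, b]`, and monotone on
either side of `0`. -/
theorem exists_smooth_profile {a b : ℝ} (ha : 0 < a) (hab : a < b) :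
    ∃ ρ : ℝ → ℝ, ContDiff ℝ ∞ ρ ∧ (∀ t, 0 ≤ ρ t) ∧ (∀ t, ρ t ≤ 1) ∧ (∀ t, |t| ≤ a → ρ t = 1) ∧
      (∀ t, b ≤ |t| → ρ t = 0) ∧ (∀ t, deriv ρ t * t ≤ 0) ∧ MonotoneOn ρ (Iic 0) ∧
      AntitoneOn ρ (Ici 0) := by
  have hD : 0 < b ^ 2 - a ^ 2 := by nlinarith
  set κ : ℝ → ℝ := fun t => (b ^ 2 - t ^ 2) / (b ^ 2 - a ^ 2) with hκ
  have hκd : ∀ t, HasDerivAt κ (-(2 * t) / (b ^ 2 - a ^ 2)) t := by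
    intro t
    have h := (((hasDerivAt_pow 2 t).const_sub (b ^ 2)).div_const (b ^ 2 - a ^ 2))
    simpa using h
  have hκs : ContDiff ℝ ∞ κ := (contDiff_const.sub (contDiff_id.pow 2)).div_const _
  have hst : ContDiff ℝ ∞ Real.smoothTransition := Real.smoothTransition.contDiff
  -- `κ` is at least `1` on `[-a, a]` and at most `0` off `(-b, b)`
  refine ⟨fun t => Real.smoothTransition (κ t), hst.comp hκs,
    fun t => Real.smoothTransition.nonneg _, fun t => Real.smoothTransition.le_one _,
    fun t ht => Real.smoothTransition.one_of_one_le ?_,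
    fun t ht => Real.smoothTransition.zero_of_nonpos ?_, fun t => ?_, ?_, ?_⟩
  · rw [hκ, one_le_div hD]
    have := sq_le_sq' (by linarith [abs_nonneg t]) ht
    rw [sq_abs] at this
    linarith
  · have := sq_le_sq' (by linarith) ht
    rw [sq_abs] at this
    exact div_nonpos_of_nonpos_of_nonneg (by linarith) hD.le
  · have h1 : HasDerivAt (fun t => Real.smoothTransition (κ t)) _ t :=
      (hst.differentiable (by simp) (κ t)).hasDerivAt.comp t (hκd t)
    rw [h1.deriv]
    have h2 : 0 ≤ deriv Real.smoothTransition (κ t) := Real.smoothTransition.monotone.deriv_nonneg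
    have h3 : deriv Real.smoothTransition (κ t) * (-(2 * t) / (b ^ 2 - a ^ 2)) * t =
        -(deriv Real.smoothTransition (κ t) * (2 * t ^ 2 / (b ^ 2 - a ^ 2))) := by ring
    rw [h3]
    have : 0 ≤ 2 * t ^ 2 / (b ^ 2 - a ^ 2) := by positivity
    linarith [mul_nonneg h2 this]
  · intro x _ y hy hxy
    refine Real.smoothTransition.monotone ?_
    have hy' : y ≤ 0 := hy
    exact div_le_div_of_nonneg_right (by nlinarith) hD.le
  · intro x hx y _ hxy
    refine Real.smoothTransition.monotone ?_
    have hx' : 0 ≤ x := hx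
    exact div_le_div_of_nonneg_right (by nlinarith) hD.le

theorem mainTheorem5 (m : ℕ) {M : Type*} [TopologicalSpace M] [T2Space M] [CompactSpace M]
    [ChartedSpace (EuclideanSpace ℝ (Fin (m + 2))) M] [IsManifold (𝓡 (m + 2)) ∞ M]
    (g : SmoothMetric (m + 2) M) (p : M) (v w : TangentSpace (𝓡 (m + 2)) p)
    (hv : g.inner p v v = 1) (hw : g.inner p w w = 1) (hvw : g.inner p v w = 0)
    (η ε : ℝ) (hε : 0 < ε) (hεη : 6 * ε < η)
    (ζ : g.normalSpace p v ≃ₗ[ℝ] EuclideanSpace ℝ (Fin (m + 1)))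
    (hζ : g.IsNormalIsometry p v ζ)
    (hζw : ζ ⟨w, hvw⟩ = EuclideanSpace.single 0 1)
    (ν : (q : M) → TangentSpace (𝓡 (m + 2)) q)
    (hν : g.IsUnitNormalField p v ζ ε ν)
    (hξ : IsDiffeoOntoImage (n := m + 2) (g.tubeMap p v ζ ν)
      (Icc (-2 * η) (2 * η) ×ˢ Metric.ball 0 ε)) :
    ∃ δ : ℝ, 0 < δ ∧ ∃ (G : ℝ → SmoothMetric (m + 2) M) (u : ℝ → ℝ → ℝ),
      IsSmoothFamilyOn G (Icc 0 δ) ∧ G 0 = g ∧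
      ∀ s ∈ Icc 0 δ, ∃ c : ℝ → M,
        (∀ t ∈ Icc (-2 * η) (2 * η), 0 ≤ u s t ∧ u s t < ε ∧
          c t = g.tubeMap p v ζ ν (t, u s t • EuclideanSpace.single 0 1)) ∧
        (G s).IsGeodesicOn c (Icc (-2 * η) (2 * η)) ∧
        (∀ t ∈ Icc (-2 * η) (2 * η),
          (G s).inner (c t) (curveVelocity (m + 2) c (Icc (-2 * η) (2 * η)) t)
            (curveVelocity (m + 2) c (Icc (-2 * η) (2 * η)) t) = 1) ∧
        ContDiffOn ℝ ∞ (u s) (Icc (-2 * η) (2 * η)) ∧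
        (∀ t ∈ Icc (-2 * η) (-η - 4 * ε) ∪ Icc (η + 4 * ε) (2 * η), u s t = 0) ∧
        (∀ t ∈ Icc (-η - 2 * ε) (η + 2 * ε), u s t = s) ∧
        (∀ t ∈ Icc (-2 * η) (2 * η), derivWithin (u s) (Icc (-2 * η) (2 * η)) t * t ≤ 0) ∧
        MonotoneOn (u s) (Icc (-2 * η) (-η)) ∧ AntitoneOn (u s) (Icc η (2 * η)) ∧
        (0 < s → ∀ t ∈ Icc (-2 * η) (2 * η), c t ∈ g.localSurface p w ν η ε \ {p}) ∧
        (G s).curveLength c (-2 * η) (2 * η) = 4 * η ∧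
        g.curveLength (fun t => g.expMap p (t • v)) (-2 * η) (2 * η) = 4 * η ∧
        (∀ q, q ∉ g.UMinus p v ν η ε ∪ g.UPlus p v ν η ε → (G s).inner q = g.inner q) := by
  have hη : 0 < η := by linarith
  have hk : m + 1 + 1 = m + 2 := rfl
  have htube := SmoothMetric.isGeodesicTube_tubeMap hη hν hξ
  obtain ⟨-, h, hh, hinv⟩ := hξ
  set f := g.tubeMap p v ζ ν with hfdef
  set e : EuclideanSpace ℝ (Fin (m + 1)) := EuclideanSpace.single 0 1 with hedef
  have he : ‖e‖ = 1 := by simp [hedef]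
  obtain ⟨ρ, hρs, hρnn, hρle, hρ1, hρ0, hρd, hρm, hρa⟩ :=
    exists_smooth_profile (a := η + 2 * ε) (b := η + 4 * ε) (by linarith) (by linarith)
  let ψ : ContDiffBump (0 : EuclideanSpace ℝ (Fin (m + 1))) :=
    ⟨ε / 3, ε / 2, by linarith, by linarith⟩
  -- the slope of the profile, cut off away from the axis of the tube
  set φ : ℝ × EuclideanSpace ℝ (Fin (m + 1)) → ℝ := fun z => deriv ρ z.1 * ψ z.2 with hφdef
  set K := SmoothMetric.transitionSet (m + 1) (η + 2 * ε) (η + 4 * ε) (ε / 2) with hKdef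
  have hKc : IsCompact K := SmoothMetric.isCompact_transitionSet _ _ _ _
  have hKmem : ∀ z ∈ K, (z.1 ∈ Ioo (-η - 6 * ε) (-η) ∨ z.1 ∈ Ioo η (η + 6 * ε)) ∧
      z.2 ∈ Metric.ball 0 ε := by
    rintro z ⟨hz1, hz2⟩
    refine ⟨hz1.imp (fun hz => ?_) fun hz => ?_, Metric.closedBall_subset_ball (by linarith) hz2⟩
    · exact ⟨by linarith [hz.1], by linarith [hz.2]⟩
    · exact ⟨by linarith [hz.1], by linarith [hz.2]⟩
  have hK : K ⊆ Ioo (-2 * η) (2 * η) ×ˢ Metric.ball 0 ε := by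
    intro z hz
    obtain ⟨hz1 | hz1, hz2⟩ := hKmem z hz
    · exact ⟨⟨by linarith [hz1.1], by linarith [hz1.2]⟩, hz2⟩
    · exact ⟨⟨by linarith [hz1.1], by linarith [hz1.2]⟩, hz2⟩
  have hφ : ∀ z, z ∉ K → φ z = 0 := fun z hz => SmoothMetric.deriv_mul_bump_eq_zero hρ1 hρ0 ψ hz
  have hρ's : ContDiff ℝ ∞ (deriv ρ) := contDiff_iff_contDiffAt.2 fun t =>
    hρs.contDiffAt.deriv_smooth
  have hφs : ContDiff ℝ ∞ φ := (hρ's.comp contDiff_fst).mul (ψ.contDiff.comp contDiff_snd)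
  have hA : SmoothMetric.IsSmoothEndo (g.tubeEndo f h (1, 0) (0, e) φ K) :=
    htube.isSmoothEndo_tubeEndo hk hh hinv hKc hK hφ hφs
  have hA2 := htube.tubeEndo_sq (w := e) hinv hK hφ
  have hclosed : IsClosed (f '' K) := (hKc.image_of_continuousOn fun z hz =>
    (htube.contMDiffAt (hK hz)).continuousAt.continuousWithinAt).isClosed
  have hIcc : -2 * η < 2 * η := by linarith
  have hball : ∀ r : ℝ, 0 ≤ r → r < ε →
      r • e ∈ Metric.ball (0 : EuclideanSpace ℝ (Fin (m + 1))) ε := by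
    intro r hr hrε
    rw [mem_ball_zero_iff, norm_smul, he, mul_one, Real.norm_of_nonneg hr]
    exact hrε
  have hunif : UniqueDiffOn ℝ (Icc (-2 * η) (2 * η)) := uniqueDiffOn_Icc hIcc
  -- the axis of the tube, a geodesic for all times
  have haxis := (g.isGeodesicOn_univ_iff _).1 (htube.geodesic 0 (Metric.mem_ball_self hε))
  have haxis_speed : ∀ t, g.gram (fun t => f (t, 0)) (1 : ℝ) 1 t = 1 := fun t =>
    ((htube.geodesic 0 (Metric.mem_ball_self hε)).gram_eq t).trans
      (htube.speed 0 (Metric.mem_ball_self hε))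
  refine ⟨ε / 4, by linarith, fun s => g.shear _ hA hA2 s, fun s t => s * ρ t,
    (g.contMDiff_shearForm hA).contMDiffOn, g.shear_zero hA hA2, fun s hs => ?_⟩
  have hσs : ContDiff ℝ ∞ (fun t => s * ρ t) := contDiff_const.mul hρs
  have hσd : ∀ t, deriv (fun t => s * ρ t) t = s * deriv ρ t := fun t =>
    deriv_const_mul s (hρs.differentiable (by simp) t)
  have hσnn : ∀ t, 0 ≤ s * ρ t := fun t => mul_nonneg hs.1 (hρnn t)
  have hσle : ∀ t, s * ρ t ≤ ε / 4 := fun t =>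
    (mul_le_of_le_one_right hs.1 (hρle t)).trans hs.2
  have hσε : ∀ t, s * ρ t < ε := fun t => (hσle t).trans_lt (by linarith)
  -- since `s ρ ≤ ε / 4`, the curve stays where `ψ` is `1`
  set c : ℝ → M := fun t => f (t, (s * ρ t) • e) with hcdef
  -- at each time, `c` agrees with a curve defined around that time which is a geodesic
  have hloc : ∀ t ∈ Icc (-2 * η) (2 * η), ∃ γ : ℝ → M,
      ContMDiffAt 𝓘(ℝ, ℝ) (𝓡 (m + 2)) ∞ γ t ∧ (g.shear _ hA hA2 s).GeodesicEqAt γ t ∧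
      (g.shear _ hA hA2 s).gram γ (1 : ℝ) 1 t = 1 ∧ c =ᶠ[𝓝[Icc (-2 * η) (2 * η)] t] γ := by
    intro t ht
    by_cases htI : t ∈ Ioo (-2 * η) (2 * η)
    · have hT : (t, (s * ρ t) • e) ∈ Ioo (-2 * η) (2 * η) ×ˢ Metric.ball 0 ε :=
        ⟨htI, hball _ (hσnn t) (hσε t)⟩
      have hslope : ∀ᶠ z in 𝓝 (t, (s * ρ t) • e), s * φ z = deriv (fun t => s * ρ t) z.1 := by
        have hmem : (s * ρ t) • e ∈ Metric.ball (0 : EuclideanSpace ℝ (Fin (m + 1))) (ε / 3) := by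
          rw [mem_ball_zero_iff, norm_smul, he, mul_one, Real.norm_of_nonneg (hσnn t)]
          linarith [hσle t]
        have hnear : ∀ᶠ z : ℝ × EuclideanSpace ℝ (Fin (m + 1)) in 𝓝 (t, (s * ρ t) • e),
            z.2 ∈ Metric.ball (0 : EuclideanSpace ℝ (Fin (m + 1))) (ε / 3) :=
          continuous_snd.continuousAt.eventually (Metric.isOpen_ball.mem_nhds hmem)
        filter_upwards [hnear] with z hz
        rw [hσd, hφdef]
        simp only
        rw [ψ.one_of_mem_closedBall (Metric.ball_subset_closedBall hz), mul_one]
      obtain ⟨h1, h2⟩ := htube.geodesicEqAt_shear hk hh hinv hK hφ hA hA2 hσs hT hslope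
      refine ⟨c, ?_, h1, h2, EventuallyEq.rfl⟩
      exact SmoothMetric.contMDiffAt_comp_curve
        (contDiffAt_id.prodMk (hσs.contDiffAt.smul contDiffAt_const)) (htube.contMDiffAt hT)
    · -- near the ends, `c` runs along the axis and the metric is unchanged
      have htabs : η + 4 * ε < |t| := by
        have : t = -2 * η ∨ t = 2 * η := by
          by_contra! hcon
          exact htI ⟨lt_of_le_of_ne ht.1 hcon.1.symm, lt_of_le_of_ne ht.2 hcon.2⟩
        rcases this with rfl | rfl
        · rw [abs_of_neg (by linarith)]
          linarith
        · rw [abs_of_pos (by linarith)]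
          linarith
      have hnotK : f (t, 0) ∉ f '' K := by
        rintro ⟨z, hz, hzt⟩
        have h1 := hinv.injOn (SmoothMetric.IsGeodesicTube.interior_subset (hK hz))
          (mk_mem_prod ht (Metric.mem_ball_self hε)) hzt
        have h2 : z.1 = t := congrArg Prod.fst h1
        exact htI (h2 ▸ (hK hz).1)
      have hmetric : ∀ᶠ q in 𝓝 (f (t, 0)), (g.shear _ hA hA2 s).inner q = g.inner q := by
        filter_upwards [hclosed.isOpen_compl.mem_nhds hnotK] with q hq
        exact g.shear_inner_of_eq_zero hA hA2 s (g.tubeEndo_of_notMem hq)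
      refine ⟨fun t => f (t, 0), haxis.1 t, (haxis.2 t).congr_metric hmetric, ?_, ?_⟩
      · refine Eq.trans ?_ (haxis_speed t)
        unfold SmoothMetric.gram
        rw [hmetric.self_of_nhds]
      · refine mem_nhdsWithin_of_mem_nhds ?_
        filter_upwards [continuous_abs.continuousAt.preimage_mem_nhds (Ioi_mem_nhds htabs)]
          with τ hτ
        simp only [hcdef, hρ0 τ (mem_Ioi.1 hτ).le, mul_zero, zero_smul]
  have hunit : ∀ t ∈ Icc (-2 * η) (2 * η), (g.shear _ hA hA2 s).inner (c t)
      (curveVelocity (m + 2) c (Icc (-2 * η) (2 * η)) t)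
      (curveVelocity (m + 2) c (Icc (-2 * η) (2 * η)) t) = 1 := by
    intro t ht
    obtain ⟨γ, hγ, -, hsp, heq⟩ := hloc t ht
    rw [SmoothMetric.inner_curveVelocity _ hIcc ht (hγ.mdifferentiableAt (by simp)) heq, hsp]
  have hzero : ∀ t ∈ Icc (-2 * η) (-η - 4 * ε) ∪ Icc (η + 4 * ε) (2 * η), s * ρ t = 0 := by
    rintro t (ht | ht)
    · rw [hρ0 t (le_abs.2 (Or.inr (by linarith [ht.2]))), mul_zero]
    · rw [hρ0 t (le_abs.2 (Or.inl ht.1)), mul_zero]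
  refine ⟨c, fun t _ => ⟨hσnn t, hσε t, rfl⟩, ⟨?_, ?_⟩, hunit, hσs.contDiffOn, hzero, ?_, ?_, ?_,
    ?_, ?_, ?_, ?_, ?_⟩
  · intro t ht
    obtain ⟨γ, hγ, -, -, heq⟩ := hloc t ht
    exact hγ.contMDiffWithinAt.congr_of_eventuallyEq heq (heq.self_of_nhdsWithin ht)
  · intro x₀ t ht hx x x' a
    obtain ⟨γ, hγ, hgeo, -, heq⟩ := hloc t ht
    exact SmoothMetric.geodesicEq_within hunif ht hγ hgeo heq x₀ hx a
  · intro t ht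
    change s * ρ t = s
    rw [hρ1 t (abs_le.2 ⟨by linarith [ht.1], ht.2⟩), mul_one]
  · intro t ht
    rw [(hσs.differentiable (by simp) t).derivWithin (hunif t ht), hσd, mul_assoc]
    exact mul_nonpos_of_nonneg_of_nonpos hs.1 (hρd t)
  · intro t ht τ hτ htτ
    exact mul_le_mul_of_nonneg_left (hρm (mem_Iic.2 (by linarith [ht.2]))
      (mem_Iic.2 (by linarith [hτ.2])) htτ) hs.1
  · intro t ht τ hτ htτ
    exact mul_le_mul_of_nonneg_left (hρa (mem_Ici.2 (by linarith [ht.1]))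
      (mem_Ici.2 (by linarith [hτ.1])) htτ) hs.1
  · intro hspos t ht
    refine ⟨⟨t, ht, s * ρ t, ⟨by linarith [hσnn t], hσε t⟩, ?_⟩, ?_⟩
    · have hsymm : (ζ.symm ((s * ρ t) • e) : TangentSpace (𝓡 (m + 2)) p) = (s * ρ t) • w := by
        rw [map_smul, ← hζw, LinearEquiv.symm_apply_apply]
        rfl
      change g.normalExp p ν t (ζ.symm ((s * ρ t) • e) : TangentSpace (𝓡 (m + 2)) p) = _
      rw [hsymm]
    · -- `p = ξ(0, 0)`, and `c` passes through `t = 0` at height `s > 0`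
      intro hcp
      have hp : f (0, 0) = p := by
        rw [hfdef, SmoothMetric.tubeMap_zero_left, SmoothMetric.slice_zero]
      have h1 := hinv.injOn (mk_mem_prod ht (hball _ (hσnn t) (hσε t)))
        (mk_mem_prod (mem_Icc.2 ⟨by linarith, by linarith⟩) (Metric.mem_ball_self hε))
        ((mem_singleton_iff.1 hcp).trans hp.symm)
      have ht0 : t = 0 := congrArg Prod.fst h1
      have h2 : (s * ρ t) • e = 0 := congrArg Prod.snd h1
      rw [ht0, hρ1 0 (by rw [abs_zero]; linarith), mul_one] at h2
      have h3 := congrArg norm h2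
      rw [norm_smul, he, mul_one, norm_zero, Real.norm_of_nonneg hs.1] at h3
      exact hspos.ne' h3
  · rw [SmoothMetric.curveLength_of_unit_speed _ hIcc.le hunit]
    ring
  · have hexp : (fun t => g.expMap p (t • v)) = fun t => f (t, 0) := by
      funext t
      exact (SmoothMetric.tubeMap_zero_right hν.2.2 t).symm
    rw [hexp, SmoothMetric.curveLength_of_unit_speed _ hIcc.le fun t ht => ?_]
    · ring
    · rw [SmoothMetric.inner_curveVelocity _ hIcc ht ((haxis.1 t).mdifferentiableAt (by simp))
        EventuallyEq.rfl, haxis_speed]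
  · intro q hq
    refine g.shear_inner_of_eq_zero hA hA2 s (g.tubeEndo_of_notMem ?_)
    rintro ⟨z, hz, rfl⟩
    obtain ⟨hz1 | hz1, hz2⟩ := hKmem z hz
    · exact hq (Or.inl ⟨z.1, hz1, _, SmoothMetric.symm_mem_normalBall hζ hz2, rfl⟩)
    · exact hq (Or.inr ⟨z.1, hz1, _, SmoothMetric.symm_mem_normalBall hζ hz2, rfl⟩)

end
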